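/- Let $\mathbb{B}$ be the commutative associative algebra over $\mathbb{C}$ with basis $\{e_1,e_2\}$ and multiplication $e_1=1$, $e_2^2=e_1+2ie_2$, with the Euclidean norm $\|z_1e_1+z_2e_2\|=\sqrt{|z_1|^2+|z_2|^2}$. Let $\mu=\{xe_1+ye_2 : x,y\in\mathbb{R}\}$ and $\Pi^+=\{xe_1+ye_2 : x,y\in\mathbb{R},\ y>0\}$; the boundary of $\Pi^+$ in $\mu$ is identified with $\mathbb{R}$. For $a=U_1e_1+U_2ie_1+U_3e_2+U_4ie_2$ with real $U_l$ write $\mathrm{U}_l[a]=U_l$. A function $\Phi:\overline{\Pi^+}\to\mathbb{B}$ is monogenic in $\Pi^+$ if for every $\zeta\in\Pi^+$ the limit of $(\Phi(\zeta+h)-\Phi(\zeta))h^{-1}$ as $h\to0$, $h\in\mu$, exists. For $u_1,u_4:\mathbb{R}\to\mathbb{R}$, a solution of the (1-4)-problem for $\Pi^+$ is a continuous function $\Phi:\overline{\Pi^+}\to\mathbb{B}$ that is monogenic in $\Pi^+$, has a limit in $\mathbb{B}$ as $\|\zeta\|\to\infty$, $\zeta\in\Pi^+$, and satisfies $\mathrm{U}_1[\Phi(x)]=u_1(x)$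 and $\mathrm{U}_4[\Phi(x)]=u_4(x)$ for all $x\in\mathbb{R}$. Theorem. Suppose that, for $l\in\{1,4\}$, the function $u_l:\mathbb{R}\to\mathbb{R}$ has a finite limit $u_l(\infty)=\lim_{|t|\to\infty}u_l(t)$ and that $$\int_0^1\frac{\omega_{\mathbb R}(u_l,\eta)}{\eta}\,d\eta<\infty,\qquad \int_0^1\frac{\omega_{\mathbb R,\infty}(u_l,\eta)}{\eta}\,d\eta<\infty,$$ where $\omega_{\mathbb R}(u,\varepsilon)=\sup_{|\tau_1-\tau_2|\le\varepsilon}|u(\tau_1)-u(\tau_2)|$ and $\omega_{\mathbb R,\infty}(u,\varepsilon)=\sup_{|\tau|\ge1/\varepsilon}|u(\tau)-u(\infty)|$. Then for every $\zeta\in\Pi^+$ and $l\in\{1,4\}$ the integral $$S_{\Pi^+}[u_l](\zeta)=\frac1{\pi i}\int_{-\infty}^{+\infty}\frac{u_l(t)(1+t\zeta)}{t^2+1}(t-\zeta)^{-1}\,dt$$ exists as a Cauchy principal value, and the general solution of the (1-4)-problem for $\Pi^+$ is $$\Phi(\zeta)=S_{\Pi^+}[u_1](\zeta)\,e_1+S_{\Pi^+}[u_4](\zeta)\,ie_2+a_1ie_1+a_2e_2,\qquad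 \zeta\in\Pi^+,$$ where $a_1,a_2$ are any real constants; that is, every solution has this form on $\Pi^+$ for some real $a_1,a_2$, and for all real $a_1,a_2$ the function given by this formula on $\Pi^+$ extends to $\overline{\Pi^+}$ as a solution. -/

import Mathlib

open Filter Topology MeasureTheory Bornology
open scoped ENNReal

noncomputable section

/-- The biharmonic algebra: the commutative associative algebra over `ℂ` with basis `e₁ = 1`, `e₂`
and multiplication `e₂ ^ 2 = e₁ + 2 i e₂`; the element `z₁ e₁ + z₂ e₂` is `⟨z₁, z₂⟩`. -/
abbrev Biharm : Type := QuadraticAlgebra ℂ 1 (2 * Complex.I)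

namespace Biharm

/-- The basis element `e₁ = 1`. -/
def e₁ : Biharm := 1

/-- The basis element `e₂`. -/
def e₂ : Biharm := ⟨0, 1⟩

theorem e₂_sq : e₂ ^ 2 = e₁ + (2 * Complex.I) • e₂ := by
  rw [sq]
  ext <;> simp [e₁, e₂, QuadraticAlgebra.re_one, QuadraticAlgebra.im_one]

/-- The basis `e₁, e₂` is biharmonic. -/
theorem biharmonic_basis : (e₁ ^ 2 + e₂ ^ 2) ^ 2 = 0 ∧ e₁ ^ 2 + e₂ ^ 2 ≠ 0 := by
  constructor
  · simp only [sq]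
    ext
    · simp [e₁, e₂, QuadraticAlgebra.re_one, QuadraticAlgebra.im_one]
      linear_combination 4 * Complex.I_mul_I
    · simp [e₁, e₂, QuadraticAlgebra.re_one, QuadraticAlgebra.im_one]
      linear_combination 8 * Complex.I * Complex.I_mul_I
  · intro h
    have := congrArg QuadraticAlgebra.im h
    simp [e₁, e₂, sq, QuadraticAlgebra.im_one] at this

/-- The coordinates of `z₁ e₁ + z₂ e₂`, as a vector of the Hermitian space `ℂ²`. -/
def coords : Biharm →ₗ[ℂ] WithLp 2 (ℂ × ℂ) where
  toFun a := WithLp.toLp 2 (a.re, a.im)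
  map_add' _ _ := rfl
  map_smul' _ _ := rfl

theorem coords_injective : Function.Injective coords := fun a b h => by
  have h' := congrArg WithLp.ofLp h
  exact QuadraticAlgebra.ext (congrArg Prod.fst h') (congrArg Prod.snd h')

instance : NormedAddCommGroup Biharm :=
  NormedAddCommGroup.induced Biharm (WithLp 2 (ℂ × ℂ)) coords coords_injective

instance : NormedSpace ℂ Biharm :=
  NormedSpace.induced ℂ Biharm (WithLp 2 (ℂ × ℂ)) coords

instance : NormedSpace ℝ Biharm :=
  NormedSpace.induced ℝ Biharm (WithLp 2 (ℂ × ℂ)) (coords.restrictScalars ℝ)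

/-- The norm is the Euclidean one. -/
theorem norm_eq (a : Biharm) : ‖a‖ = Real.sqrt (‖a.re‖ ^ 2 + ‖a.im‖ ^ 2) :=
  WithLp.prod_norm_eq_of_L2 _

instance : CompleteSpace Biharm := FiniteDimensional.complete ℂ Biharm

/-- The point `x e₁ + y e₂` of the biharmonic plane. -/
def pt (x y : ℝ) : Biharm := x • e₁ + y • e₂

/-- The biharmonic plane `μ`, the real linear span of `e₁` and `e₂`. -/
def plane : Set Biharm := {ζ | ∃ x y : ℝ, ζ = pt x y}

/-- Every nonzero element of the biharmonic plane is invertible, so that `Ring.inverse` is a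
genuine inverse there. -/
theorem isUnit_of_mem_plane {ζ : Biharm} (h : ζ ∈ plane) (h0 : ζ ≠ 0) : IsUnit ζ := by
  obtain ⟨x, y, rfl⟩ := h
  have hz : (x : ℂ) + y * Complex.I ≠ 0 := by
    intro h
    apply h0
    have h1 := congrArg Complex.re h
    have h2 := congrArg Complex.im h
    simp at h1 h2
    simp [pt, h1, h2]
  refine IsUnit.of_mul_eq_one
    (((x + y * Complex.I) ^ 2)⁻¹ • (⟨x + 2 * Complex.I * y, -y⟩ : Biharm)) ?_
  have hi := Complex.I_sq
  ext
  · simp [pt, e₁, e₂, QuadraticAlgebra.re_one, QuadraticAlgebra.im_one]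
    field_simp
    linear_combination (-(y : ℂ) ^ 2) * hi
  · simp [pt, e₁, e₂, QuadraticAlgebra.re_one, QuadraticAlgebra.im_one]
    field_simp
    ring

/-- The open half-plane `Π⁺ = {x e₁ + y e₂ : y > 0}`. -/
def halfPlane : Set Biharm := {ζ | ∃ x y : ℝ, 0 < y ∧ ζ = pt x y}

/-- The closed half-plane `{x e₁ + y e₂ : y ≥ 0}`, the closure of `Π⁺`. -/
def closedHalfPlane : Set Biharm := {ζ | ∃ x y : ℝ, 0 ≤ y ∧ ζ = pt x y}

/-- The components of `U₁ e₁ + U₂ i e₁ + U₃ e₂ + U₄ i e₂` that the (1-4)-problem prescribes. -/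
def U₁ (a : Biharm) : ℝ := a.re.re

/-- See `U₁`. -/
def U₄ (a : Biharm) : ℝ := a.im.im

/-- `Φ` has the derivative `d` at `ζ`: the limit of `(Φ (ζ + h) - Φ ζ) h⁻¹` as `h → 0`, `h ∈ μ`,
`h ≠ 0`, is `d`. -/
def HasMonogenicDerivAt (Φ : Biharm → Biharm) (d ζ : Biharm) : Prop :=
  Tendsto (fun h : Biharm => (Φ (ζ + h) - Φ ζ) * Ring.inverse h) (𝓝[plane \ {0}] 0) (𝓝 d)

/-- `Φ` is monogenic in the domain `D` of the biharmonic plane (`D` is open in that plane, so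
that the values of `Φ` outside `D` do not matter). -/
def MonogenicOn (Φ : Biharm → Biharm) (D : Set Biharm) : Prop :=
  ∀ ζ ∈ D, ∃ d, HasMonogenicDerivAt Φ d ζ

/-- `Φ`, a function on the closed half-plane (its values elsewhere are irrelevant), is a solution of
the (1-4)-problem for `Π⁺` with boundary data `u₁`, `u₄`. -/
structure IsSolution14 (u₁ u₄ : ℝ → ℝ) (Φ : Biharm → Biharm) : Prop where
  continuousOn : ContinuousOn Φ closedHalfPlane
  monogenicOn : MonogenicOn Φ halfPlane
  boundary₁ : ∀ x : ℝ, U₁ (Φ (pt x 0)) = u₁ x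
  boundary₄ : ∀ x : ℝ, U₄ (Φ (pt x 0)) = u₄ x
  limit_infty : ∃ L : Biharm, Tendsto Φ (cobounded Biharm ⊓ 𝓟 halfPlane) (𝓝 L)

/-- The modulus of continuity of `u` on `ℝ`, with values in `[0, ∞]`. -/
def modulus (u : ℝ → ℝ) (ε : ℝ) : ℝ≥0∞ :=
  ⨆ (s : ℝ) (t : ℝ) (_ : |s - t| ≤ ε), ENNReal.ofReal |u s - u t|

/-- The local modulus of continuity of `u` centered at the infinitely remote point, where `u` has
the limit `c`. -/
def modulusInfty (u : ℝ → ℝ) (c ε : ℝ) : ℝ≥0∞ :=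
  ⨆ (t : ℝ) (_ : 1 / ε ≤ |t|), ENNReal.ofReal |u t - c|

/-- The Dini condition `∫₀¹ ω(η) / η dη < ∞`. -/
def Dini (ω : ℝ → ℝ≥0∞) : Prop :=
  ∫⁻ η in Set.Ioc (0 : ℝ) 1, ω η / ENNReal.ofReal η < ∞

/-- The integrand `u(t) (1 + t ζ) (t² + 1)⁻¹ (t - ζ)⁻¹`. -/
def schwarzIntegrand (u : ℝ → ℝ) (ζ : Biharm) (t : ℝ) : Biharm :=
  (u t / (t ^ 2 + 1)) • ((e₁ + t • ζ) * Ring.inverse (t • e₁ - ζ))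

/-- `I` is the Cauchy principal value of the integral of `f` over the real line (for `f` without
singularities at finite points). -/
def HasPV (f : ℝ → Biharm) (I : Biharm) : Prop :=
  (∀ R : ℝ, IntervalIntegrable f volume (-R) R) ∧
    Tendsto (fun R : ℝ => ∫ t in (-R)..R, f t) atTop (𝓝 I)

/-- The Cauchy principal value of the integral of `f` over the real line (meaningful if `HasPV f I`
for some `I`). -/
def pv (f : ℝ → Biharm) : Biharm :=
  limUnder atTop (fun R : ℝ => ∫ t in (-R)..R, f t)

/-- The Schwarz-type integral `S_{Π⁺}[u](ζ)`. -/
def S (u : ℝ → ℝ) (ζ : Biharm) : Biharm :=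
  (1 / (Real.pi * Complex.I)) • pv (schwarzIntegrand u ζ)

/-- `S_{Π⁺}[u₁](ζ) e₁ + S_{Π⁺}[u₄](ζ) i e₂ + a₁ i e₁ + a₂ e₂`. -/
def solutionFormula (u₁ u₄ : ℝ → ℝ) (a₁ a₂ : ℝ) (ζ : Biharm) : Biharm :=
  S u₁ ζ * e₁ + S u₄ ζ * (Complex.I • e₂) + a₁ • (Complex.I • e₁) + a₂ • e₂

end Biharm

end

namespace SchwarzIntegral

/-! ### The Cauchy and Schwarz kernels of the upper half-plane -/

/-! The element `ρ = e₂ - i` satisfies `ρ² = 0`, so the algebra consists of dual numbers `z + wρ`,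
and the point `x + y e₂` of `μ` is `z + yρ` with `z = x + iy`. Separating the difference quotient
into its two components shows that the monogenic functions on `Π⁺` are exactly `F + (yF' + G)ρ` with
`F`, `G` holomorphic in the upper half-plane (`monogenicOn_iff`).

The boundary conditions then decouple. If `yF'` tends to `0` at the real axis, they say `Re F = u₁ -
u₄` and `Im G = u₄` there: two classical Schwarz problems. Likewise `S[u]` is `s + y s' ρ`, where
`s` is the classical Schwarz integral of `u` (`S_ptc`).

Existence rests on the extension of `s` to a continuous function on the closed half-plane with real
part `u` on the axis and a limit at infinity (`exists_extension`). The Dini conditions supply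
integrable majorants for a regularised Cauchy integral, and dominated convergence does the rest. The
term `yF'` is controlled by Cauchy's estimate on discs of radius `y/2`.

For uniqueness, the difference of two solutions has a component `F` with zero real part on the axis,
constant by Phragmén–Lindelöf applied to `exp (±F)`. Hence the `yF'` terms cancel, and the same
argument applies to the `ρ`-component (`solution_sub_solution`). -/

theorem im_pos_isOpen : IsOpen {z : ℂ | 0 < z.im} := isOpen_lt continuous_const Complex.continuous_im

theorem ofReal_sub_ne_zero {z : ℂ} (hz : 0 < z.im) (t : ℝ) : (t : ℂ) - z ≠ 0 := by
  intro h
  have := congrArg Complex.im h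
  simp at this
  exact hz.ne' this

theorem im_le_norm_ofReal_sub (z : ℂ) (t : ℝ) : z.im ≤ ‖(t : ℂ) - z‖ := by
  have h := Complex.abs_im_le_norm ((t : ℂ) - z)
  simp only [Complex.sub_im, Complex.ofReal_im, zero_sub, abs_neg] at h
  exact (le_abs_self _).trans h

theorem norm_ofReal_sub_I_sq (t : ℝ) : ‖(t : ℂ) - Complex.I‖ ^ 2 = 1 + t ^ 2 := by
  rw [← Complex.normSq_eq_norm_sq, Complex.normSq_apply]
  simp
  ring

theorem norm_ofReal_sub_I_pos (t : ℝ) : 0 < ‖(t : ℂ) - Complex.I‖ :=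
  norm_pos_iff.2 (ofReal_sub_ne_zero (by simp) t)

/-- Comparison of the Cauchy kernels at `z` and at `i`. -/
theorem norm_inv_ofReal_sub_le {z : ℂ} {δ B : ℝ} (hδ : 0 < δ) (hz : δ ≤ z.im)
    (hB : ‖z - Complex.I‖ ≤ B) (t : ℝ) :
    ‖((t : ℂ) - z)⁻¹‖ ≤ (1 + B / δ) * ‖(t : ℂ) - Complex.I‖⁻¹ := by
  have h1 : δ ≤ ‖(t : ℂ) - z‖ := hz.trans (im_le_norm_ofReal_sub z t)
  have h0 : 0 < ‖(t : ℂ) - z‖ := hδ.trans_le h1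
  have hB0 : 0 ≤ B := (norm_nonneg _).trans hB
  rw [norm_inv, ← div_eq_mul_inv, inv_le_iff_one_le_mul₀ h0, div_mul_eq_mul_div,
    one_le_div (norm_ofReal_sub_I_pos t)]
  calc ‖(t : ℂ) - Complex.I‖ = ‖((t : ℂ) - z) + (z - Complex.I)‖ := by ring_nf
    _ ≤ ‖(t : ℂ) - z‖ + B := (norm_add_le _ _).trans (by gcongr)
    _ ≤ ‖(t : ℂ) - z‖ + B / δ * ‖(t : ℂ) - z‖ := by
        gcongr
        rw [div_mul_eq_mul_div, le_div_iff₀ hδ]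
        gcongr
    _ = _ := by ring

theorem norm_inv_ofReal_sub_sq_le {z : ℂ} {δ B : ℝ} (hδ : 0 < δ) (hz : δ ≤ z.im)
    (hB : ‖z - Complex.I‖ ≤ B) (t : ℝ) :
    ‖(((t : ℂ) - z) ^ 2)⁻¹‖ ≤ (1 + B / δ) ^ 2 * (1 + t ^ 2)⁻¹ := by
  rw [← inv_pow, norm_pow, ← norm_ofReal_sub_I_sq, ← inv_pow, ← mul_pow]
  gcongr
  exact norm_inv_ofReal_sub_le hδ hz hB t

/-- The Schwarz kernel `(1 + t z) / ((t - z) (t² + 1))`. -/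
noncomputable def kernel (z : ℂ) (t : ℝ) : ℂ := ((t : ℂ) - z)⁻¹ - (t / (t ^ 2 + 1) : ℝ)

/-- Partial fractions: the term subtracted from the Cauchy kernel is real and independent of `z`, so
it changes neither the `z`-derivative nor the boundary jump. -/
theorem kernel_eq {z : ℂ} (hz : 0 < z.im) (t : ℝ) :
    kernel z t = (1 + t * z) * ((t : ℂ) - z)⁻¹ * ((t : ℂ) ^ 2 + 1)⁻¹ := by
  have h1 := ofReal_sub_ne_zero hz t
  have h2 : (t : ℂ) ^ 2 + 1 ≠ 0 := by exact_mod_cast (by positivity : t ^ 2 + 1 ≠ 0)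
  rw [kernel]
  push_cast
  field_simp
  ring

/-- Writing `1 + tz = (1 + z²) + z(t - z)` shows that the kernel decays quadratically, so bounded
continuous data already give absolute convergence. -/
theorem norm_kernel_le {z : ℂ} (hz : 0 < z.im) (t : ℝ) :
    ‖kernel z t‖ ≤ ((1 + ‖z‖ ^ 2) / z.im + ‖z‖) * (1 + t ^ 2)⁻¹ := by
  rw [kernel_eq hz, norm_mul]
  have h2 : ‖((t : ℂ) ^ 2 + 1)⁻¹‖ = (1 + t ^ 2)⁻¹ := by
    rw [norm_inv, show (t : ℂ) ^ 2 + 1 = ((t ^ 2 + 1 : ℝ) : ℂ) by push_cast; rfl, Complex.norm_real,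
      Real.norm_of_nonneg (by positivity), add_comm]
  rw [h2]
  gcongr
  have h0 : 0 < ‖(t : ℂ) - z‖ := norm_pos_iff.2 (ofReal_sub_ne_zero hz t)
  rw [norm_mul, norm_inv, ← div_eq_mul_inv, div_le_iff₀ h0]
  calc ‖1 + (t : ℂ) * z‖ = ‖1 + z ^ 2 + z * ((t : ℂ) - z)‖ := by ring_nf
    _ ≤ 1 + ‖z‖ ^ 2 + ‖z‖ * ‖(t : ℂ) - z‖ := by
        refine (norm_add_le _ _).trans ?_
        rw [norm_mul]
        gcongr
        refine (norm_add_le _ _).trans ?_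
        simp
    _ ≤ (1 + ‖z‖ ^ 2) / z.im * ‖(t : ℂ) - z‖ + ‖z‖ * ‖(t : ℂ) - z‖ := by
        gcongr
        rw [div_mul_eq_mul_div, le_div_iff₀ hz]
        gcongr
        exact im_le_norm_ofReal_sub z t
    _ = _ := by ring

theorem continuous_inv_ofReal_sub {z : ℂ} (hz : 0 < z.im) :
    Continuous fun t : ℝ => ((t : ℂ) - z)⁻¹ :=
  (Complex.continuous_ofReal.sub continuous_const).inv₀ (ofReal_sub_ne_zero hz)

theorem continuous_kernel {z : ℂ} (hz : 0 < z.im) : Continuous (kernel z) := by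
  refine (continuous_inv_ofReal_sub hz).sub (Complex.continuous_ofReal.comp ?_)
  exact continuous_id.div (by fun_prop) fun t => by positivity

variable {u : ℝ → ℝ} {M : ℝ}

theorem integrable_mul_kernel (hu : Continuous u) (hM : ∀ t, |u t| ≤ M) {z : ℂ} (hz : 0 < z.im) :
    Integrable fun t => (u t : ℂ) * kernel z t := by
  refine (integrable_inv_one_add_sq.const_mul
    (M * ((1 + ‖z‖ ^ 2) / z.im + ‖z‖))).mono'
    ((Complex.continuous_ofReal.comp hu).mul (continuous_kernel hz)).aestronglyMeasurable
    (Eventually.of_forall fun t => ?_)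
  rw [norm_mul, Complex.norm_real, Real.norm_eq_abs, mul_assoc]
  exact mul_le_mul (hM t) (norm_kernel_le hz t) (norm_nonneg _) ((abs_nonneg _).trans (hM t))

/-- The Schwarz integral of the upper half-plane. -/
noncomputable def schwarz (u : ℝ → ℝ) (z : ℂ) : ℂ :=
  (Real.pi * Complex.I)⁻¹ * ∫ t, (u t : ℂ) * kernel z t

/-- Differentiation under the integral: on the disc of radius `Im z / 2` all kernels are comparable
with the one at `i`, which gives a common majorant `C / (1 + t²)`. -/
theorem integrable_and_hasDerivAt_integral_mul_kernel (hu : Continuous u) (hM : ∀ t, |u t| ≤ M) {z : ℂ} (hz : 0 < z.im) :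
    Integrable (fun t : ℝ => (u t : ℂ) * (((t : ℂ) - z) ^ 2)⁻¹) ∧
      HasDerivAt (fun w => ∫ t, (u t : ℂ) * kernel w t)
        (∫ t, (u t : ℂ) * (((t : ℂ) - z) ^ 2)⁻¹) z := by
  have hM0 : 0 ≤ M := (abs_nonneg _).trans (hM 0)
  have hball : ∀ w ∈ Metric.ball z (z.im / 2), z.im / 2 ≤ w.im ∧
      ‖w - Complex.I‖ ≤ ‖z - Complex.I‖ + z.im / 2 := by
    intro w hw
    rw [mem_ball_iff_norm] at hw
    constructor
    · have := (Complex.abs_im_le_norm (w - z)).trans hw.le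
      rw [Complex.sub_im, abs_le] at this
      linarith [this.1]
    · calc ‖w - Complex.I‖ = ‖(z - Complex.I) + (w - z)‖ := by ring_nf
        _ ≤ _ := (norm_add_le _ _).trans (by gcongr)
  have hpos : ∀ w ∈ Metric.ball z (z.im / 2), 0 < w.im := fun w hw =>
    (half_pos hz).trans_le (hball w hw).1
  refine hasDerivAt_integral_of_dominated_loc_of_deriv_le
    (Metric.ball_mem_nhds z (half_pos hz)) (bound := fun t => M *
      ((1 + (‖z - Complex.I‖ + z.im / 2) / (z.im / 2)) ^ 2 * (1 + t ^ 2)⁻¹))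
    (F' := fun w t => (u t : ℂ) * (((t : ℂ) - w) ^ 2)⁻¹) ?_ (integrable_mul_kernel hu hM hz)
    ?_ (Eventually.of_forall fun t w hw => ?_)
    ((integrable_inv_one_add_sq.const_mul _).const_mul _)
    (Eventually.of_forall fun t w hw => ?_)
  · filter_upwards [Metric.ball_mem_nhds z (half_pos hz)] with w hw
    exact (integrable_mul_kernel hu hM (hpos w hw)).aestronglyMeasurable
  · refine ((Complex.continuous_ofReal.comp hu).mul ?_).aestronglyMeasurable
    exact ((continuous_inv_ofReal_sub hz).pow 2).congr fun t => by simp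
  · rw [norm_mul, Complex.norm_real, Real.norm_eq_abs]
    exact mul_le_mul (hM t) (norm_inv_ofReal_sub_sq_le (half_pos hz) (hball w hw).1
      (hball w hw).2 t) (norm_nonneg _) hM0
  · have h := ((hasDerivAt_const w (t : ℂ)).sub (hasDerivAt_id w)).inv
      (ofReal_sub_ne_zero (hpos w hw) t)
    have h2 := (h.sub_const ((t / (t ^ 2 + 1) : ℝ) : ℂ)).const_mul (u t : ℂ)
    exact h2.congr_deriv (by simp)

theorem integrable_mul_inv_sq (hu : Continuous u) (hM : ∀ t, |u t| ≤ M) {z : ℂ} (hz : 0 < z.im) :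
    Integrable fun t : ℝ => (u t : ℂ) * (((t : ℂ) - z) ^ 2)⁻¹ :=
  (integrable_and_hasDerivAt_integral_mul_kernel hu hM hz).1

theorem hasDerivAt_schwarz (hu : Continuous u) (hM : ∀ t, |u t| ≤ M) {z : ℂ} (hz : 0 < z.im) :
    HasDerivAt (schwarz u)
      ((Real.pi * Complex.I)⁻¹ * ∫ t, (u t : ℂ) * (((t : ℂ) - z) ^ 2)⁻¹) z :=
  (integrable_and_hasDerivAt_integral_mul_kernel hu hM hz).2.const_mul _

theorem tendsto_inv_ofReal_sub (z : ℂ) :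
    Tendsto (fun t : ℝ => ((t : ℂ) - z)⁻¹) (cobounded ℝ) (𝓝 0) := by
  refine tendsto_inv₀_cobounded.comp ?_
  refine tendsto_norm_atTop_iff_cobounded.1 ?_
  have h : Tendsto (fun t : ℝ => ‖t‖ - ‖z‖) (cobounded ℝ) atTop :=
    tendsto_atTop_add_const_right _ _ tendsto_norm_cobounded_atTop
  refine tendsto_atTop_mono (fun t => ?_) h
  simpa using norm_sub_norm_le (t : ℂ) z

theorem integral_inv_sq {z : ℂ} (hz : 0 < z.im) : ∫ t : ℝ, (((t : ℂ) - z) ^ 2)⁻¹ = 0 := by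
  have hi := integrable_mul_inv_sq (u := fun _ => 1) (M := 1) continuous_const (by simp) hz
  simp only [Complex.ofReal_one, one_mul] at hi
  have hd : ∀ t : ℝ, HasDerivAt (fun t : ℝ => -((t : ℂ) - z)⁻¹) ((((t : ℂ) - z) ^ 2)⁻¹) t := by
    intro t
    have h := (((hasDerivAt_id t).ofReal_comp.sub_const z).inv (ofReal_sub_ne_zero hz t)).neg
    exact h.congr_deriv (by simp [neg_div])
  have hT := (tendsto_inv_ofReal_sub z).neg
  rw [neg_zero] at hT
  have h := integral_of_hasDerivAt_of_tendsto hd hi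
    (hT.mono_left (by rw [IsOrderBornology.cobounded_eq]; exact le_sup_left)) (hT.mono_left (by rw [IsOrderBornology.cobounded_eq]; exact le_sup_right))
  simpa using h

/-- The derivative is an integral of `(t - z)⁻²`, hence zero, so it is enough to evaluate at `z =
i`, where the kernel reduces to `i / (1 + t²)`. -/
theorem schwarz_one {z : ℂ} (hz : 0 < z.im) : schwarz (fun _ => 1) z = 1 := by
  have hd : ∀ w : ℂ, 0 < w.im → HasDerivAt (schwarz fun _ => 1) 0 w := by
    intro w hw
    have h := hasDerivAt_schwarz (u := fun _ => 1) (M := 1) continuous_const (by simp) hw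
    simpa [integral_inv_sq hw] using h
  have hI : schwarz (fun _ => 1) Complex.I = 1 := by
    have hk : ∀ t : ℝ, ((1 : ℝ) : ℂ) * kernel Complex.I t = Complex.I * ((1 + t ^ 2)⁻¹ : ℝ) := by
      intro t
      have h1 : (t : ℂ) - Complex.I ≠ 0 := ofReal_sub_ne_zero (by simp) t
      rw [kernel_eq (by simp), show 1 + (t : ℂ) * Complex.I = Complex.I * ((t : ℂ) - Complex.I) by
        linear_combination Complex.I_sq, mul_assoc Complex.I, mul_inv_cancel₀ h1]
      push_cast
      ring
    rw [schwarz, integral_congr_ae (Eventually.of_forall hk), integral_const_mul, integral_complex_ofReal,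
      integral_univ_inv_one_add_sq]
    have : (Real.pi : ℂ) ≠ 0 := by exact_mod_cast Real.pi_ne_zero
    field_simp
  rw [← hI]
  refine im_pos_isOpen.is_const_of_deriv_eq_zero (𝕜 := ℂ)
    (convex_halfSpace_im_gt 0).isPreconnected
    (fun w hw => (hd w hw).differentiableAt.differentiableWithinAt)
    (fun w hw => (hd w hw).deriv) hz (by simp)

end SchwarzIntegral

namespace SchwarzIntegral

/-! ### Boundary behaviour of the Cauchy integral -/

/-- The infinitely remote point of the closed upper half-plane. -/
noncomputable def atInfty : Filter ℂ := cobounded ℂ ⊓ 𝓟 {z | 0 ≤ z.im}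

instance : (atInfty).IsCountablyGenerated := by
  rw [atInfty, ← comap_norm_atTop]
  infer_instance

/-- This reduces limits at infinity of products `N(x) D(y)` to one factor tending to zero while the
other stays bounded. -/
theorem atInfty_le : atInfty ≤ comap Complex.re (cobounded ℝ) ⊔ comap Complex.im atTop := by
  have h1 : cobounded ℂ ≤ comap Complex.re (cobounded ℝ) ⊔ comap Complex.im (cobounded ℝ) := by
    intro s hs
    obtain ⟨⟨a, ha, has⟩, ⟨b, hb, hbs⟩⟩ := hs
    rw [← isCobounded_def, ← isBounded_compl_iff, isBounded_iff_forall_norm_le] at ha hb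
    obtain ⟨A, hA⟩ := ha
    obtain ⟨B, hB⟩ := hb
    rw [← isCobounded_def, ← isBounded_compl_iff, isBounded_iff_forall_norm_le]
    refine ⟨A + B, fun z hz => ?_⟩
    have h1 : z.re ∈ aᶜ := fun h => hz (has h)
    have h2 : z.im ∈ bᶜ := fun h => hz (hbs h)
    exact (Complex.norm_le_abs_re_add_abs_im z).trans (add_le_add (hA _ h1) (hB _ h2))
  intro s hs
  obtain ⟨hs1, b, hb, hbs⟩ := hs
  -- In the closed half-plane `Im z → -∞` cannot occur; adjoining the negative ray lets the
  -- two-sided statement apply.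
  have hb' : b ∪ Set.Iio 0 ∈ cobounded ℝ := by
    rw [IsOrderBornology.cobounded_eq]
    exact ⟨mem_of_superset (Iio_mem_atBot 0) Set.subset_union_right,
      mem_of_superset hb Set.subset_union_left⟩
  have h3 : s ∪ {z | z.im < 0} ∈ cobounded ℂ := h1 ⟨mem_of_superset hs1 Set.subset_union_left,
    b ∪ Set.Iio 0, hb', fun z hz => hz.imp (fun h => hbs h) id⟩
  rw [atInfty, mem_inf_principal]
  filter_upwards [h3] with z hz hz0
  exact hz.resolve_right (not_lt.2 hz0)

theorem tendsto_mul_atInfty {N D : ℝ → ℂ} (hN : Tendsto N (cobounded ℝ) (𝓝 0)) {A : ℝ}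
    (hNb : ∀ x, ‖N x‖ ≤ A) (hD : Tendsto D atTop (𝓝 0)) {B : ℝ} (hDb : ∀ y, ‖D y‖ ≤ B) :
    Tendsto (fun z : ℂ => N z.re * D z.im) atInfty (𝓝 0) := by
  refine Tendsto.mono_left (Tendsto.sup ?_ ?_) atInfty_le
  · exact (hN.comp tendsto_comap).zero_mul_isBoundedUnder_le
      (isBoundedUnder_of ⟨B, fun z => hDb z.im⟩)
  · exact isBoundedUnder_le_mul_tendsto_zero (isBoundedUnder_of ⟨A, fun z => hNb z.re⟩)
      (hD.comp tendsto_comap)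

/-- A continuous function vanishing at infinity with integrable majorants of its increments and of
its size at infinity. -/
structure DiniMajorants (v g ψ : ℝ → ℝ) : Prop where
  cont : Continuous v
  tendsto_zero : Tendsto v (cobounded ℝ) (𝓝 0)
  local_le : ∀ x s, |s| < 1 → |v (x + s) - v x| ≤ g s * |s|
  g_nonneg : ∀ s, 0 ≤ g s
  g_int : Integrable g
  anti : Antitone ψ
  le_psi : ∀ t, |v t| ≤ ψ |t|
  psi_int : Integrable fun s : ℝ => ψ |s| / (1 + |s|)

/-- The numerator of the regularised Cauchy integral. -/
noncomputable def numer (v : ℝ → ℝ) (x s : ℝ) : ℝ := v (x + s) - if |s| < 1 then v x else 0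

/-- The integrand of the regularised Cauchy integral. -/
noncomputable def regIntegrand (v : ℝ → ℝ) (z : ℂ) (s : ℝ) : ℂ :=
  (numer v z.re s : ℂ) * ((s : ℂ) - z.im * Complex.I)⁻¹

/-- The regularised Cauchy integral. -/
noncomputable def regCauchy (v : ℝ → ℝ) (z : ℂ) : ℂ := ∫ s, regIntegrand v z s

theorem norm_inv_sub_mul_I_le {s : ℝ} (hs : s ≠ 0) (y : ℝ) :
    ‖((s : ℂ) - y * Complex.I)⁻¹‖ ≤ |s|⁻¹ := by
  rw [norm_inv]
  refine inv_anti₀ (abs_pos.2 hs) ?_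
  simpa using Complex.abs_re_le_norm ((s : ℂ) - y * Complex.I)

theorem sub_mul_I_ne_zero {s : ℝ} (hs : s ≠ 0) (y : ℝ) : (s : ℂ) - y * Complex.I ≠ 0 := by
  intro h
  apply hs
  simpa using congrArg Complex.re h

theorem ae_ne_zero : ∀ᵐ s : ℝ, s ≠ 0 := by
  simp [ae_iff]

namespace DiniMajorants

variable {v g ψ : ℝ → ℝ} (h : DiniMajorants v g ψ)

include h

theorem psi_nonneg {r : ℝ} (hr : 0 ≤ r) : 0 ≤ ψ r := by
  have := (abs_nonneg _).trans (h.le_psi r)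
  rwa [abs_of_nonneg hr] at this

theorem bound (t : ℝ) : |v t| ≤ ψ 0 := (h.le_psi t).trans (h.anti (abs_nonneg t))

theorem majorant_int : Integrable fun s : ℝ => g s + 2 * (ψ |s / 2| / (1 + |s / 2|)) :=
  h.g_int.add ((h.psi_int.comp_div two_ne_zero).const_mul 2)

/-- For `|s| < 1` the increment bound cancels the singularity `1/|s|`. For `|s| ≥ 1` the argument `x
+ s` is at least `|s|/2` from `0`, so the decay `ψ` applies. The majorant does not depend on `z`. -/
theorem norm_regIntegrand_le {z : ℂ} {s : ℝ} (hs : s ≠ 0) (hzs : |s| < 1 ∨ |s| / 2 ≤ |z.re + s|) :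
    ‖regIntegrand v z s‖ ≤ g s + 2 * (ψ |s / 2| / (1 + |s / 2|)) := by
  have hψ := h.psi_nonneg (abs_nonneg (s / 2))
  have hs0 := abs_pos.2 hs
  have h1 : ‖regIntegrand v z s‖ ≤ |numer v z.re s| * |s|⁻¹ := by
    rw [regIntegrand, norm_mul, Complex.norm_real, Real.norm_eq_abs]
    gcongr
    exact norm_inv_sub_mul_I_le hs _
  refine h1.trans ?_
  by_cases hs1 : |s| < 1
  · have h2 := h.local_le z.re s hs1
    rw [numer, if_pos hs1]
    have h3 : |v (z.re + s) - v z.re| * |s|⁻¹ ≤ g s := by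
      rwa [← div_eq_mul_inv, div_le_iff₀ hs0]
    have : 0 ≤ 2 * (ψ |s / 2| / (1 + |s / 2|)) := by positivity
    linarith
  · have h2 := hzs.resolve_left hs1
    rw [numer, if_neg hs1, sub_zero]
    have h3 : |v (z.re + s)| ≤ ψ |s / 2| := (h.le_psi _).trans (h.anti (by
      rwa [abs_div, abs_two]))
    have h4 : |s|⁻¹ ≤ 2 * (1 + |s / 2|)⁻¹ := by
      rw [abs_div, abs_two, inv_le_iff_one_le_mul₀ hs0, mul_assoc, inv_mul_eq_div, ← mul_div_assoc,
        one_le_div (by positivity)]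
      linarith
    have h5 : |v (z.re + s)| * |s|⁻¹ ≤ ψ |s / 2| * (2 * (1 + |s / 2|)⁻¹) := by gcongr
    have := h.g_nonneg s
    rw [div_eq_mul_inv]
    linarith

theorem measurable_regIntegrand (z : ℂ) : Measurable (regIntegrand v z) := by
  have hn : Measurable (numer v z.re) :=
    (h.cont.measurable.comp (measurable_const_add _)).sub
      (Measurable.ite (measurableSet_lt measurable_norm measurable_const)
        measurable_const measurable_const)
  exact (Complex.measurable_ofReal.comp hn).mul
    (Complex.measurable_ofReal.sub_const _).inv

/-- The case left out of the uniform estimate forces `|s| ≤ 2|x|`, a bounded range when `x` is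
bounded. -/
theorem norm_regIntegrand_le_of_abs_le {R : ℝ} {z : ℂ} (hz : |z.re| ≤ R) {s : ℝ} (hs : s ≠ 0) :
    ‖regIntegrand v z s‖ ≤ (g s + 2 * (ψ |s / 2| / (1 + |s / 2|))) +
      (Set.Icc (-(2 * R)) (2 * R)).indicator (fun _ => ψ 0) s := by
  have hψ0 := h.psi_nonneg le_rfl
  by_cases hzs : |s| < 1 ∨ |s| / 2 ≤ |z.re + s|
  · exact (h.norm_regIntegrand_le hs hzs).trans
      (le_add_of_nonneg_right (Set.indicator_nonneg (fun _ _ => hψ0) _))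
  · push Not at hzs
    have h1 : |s| ≤ 2 * R := by
      have : |s| ≤ |z.re + s| + |z.re| := by
        calc |s| = |(z.re + s) - z.re| := by ring_nf
          _ ≤ _ := abs_sub _ _
      linarith
    rw [Set.indicator_of_mem (Set.mem_Icc.2 (abs_le.1 h1))]
    have h2 : ‖regIntegrand v z s‖ ≤ ψ 0 * 1 := by
      rw [regIntegrand, norm_mul, Complex.norm_real, Real.norm_eq_abs, numer, if_neg hzs.1.not_gt,
        sub_zero]
      gcongr
      · exact h.bound _
      · exact (norm_inv_sub_mul_I_le hs _).trans (inv_le_one_of_one_le₀ hzs.1)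
    have := h.g_nonneg s
    have := h.psi_nonneg (abs_nonneg (s / 2))
    have : 0 ≤ 2 * (ψ |s / 2| / (1 + |s / 2|)) := by positivity
    linarith

theorem bound_int (R : ℝ) : Integrable fun s => (g s + 2 * (ψ |s / 2| / (1 + |s / 2|))) +
    (Set.Icc (-(2 * R)) (2 * R)).indicator (fun _ => ψ 0) s :=
  h.majorant_int.add ((integrable_indicator_iff measurableSet_Icc).2
    (integrableOn_const (by simp)))

theorem integrable_regIntegrand (z : ℂ) : Integrable (regIntegrand v z) :=
  (h.bound_int |z.re|).mono' (h.measurable_regIntegrand z).aestronglyMeasurable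
    (ae_ne_zero.mono fun _ hs => h.norm_regIntegrand_le_of_abs_le le_rfl hs)

theorem continuous_numer (s : ℝ) : Continuous fun x => numer v x s := by
  refine (h.cont.comp (continuous_add_const s)).sub ?_
  split_ifs
  · exact h.cont
  · exact continuous_const

/-- The majorant is uniform in `y`, so dominated convergence works across `y = 0`, where the
integrand is singular only at the null set `s = 0`. -/
theorem continuous_regCauchy : Continuous (regCauchy v) := by
  refine continuous_iff_continuousAt.2 fun z₀ => ?_
  refine continuousAt_of_dominated
    (Eventually.of_forall fun z => (h.measurable_regIntegrand z).aestronglyMeasurable) ?_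
    (h.bound_int (|z₀.re| + 1)) (ae_ne_zero.mono fun s hs => ?_)
  · have : ∀ᶠ z : ℂ in 𝓝 z₀, |z.re| < |z₀.re| + 1 :=
      (Complex.continuous_re.abs.continuousAt).eventually_lt continuousAt_const (by simp)
    filter_upwards [this] with z hz
    exact ae_ne_zero.mono fun s hs => h.norm_regIntegrand_le_of_abs_le hz.le hs
  · refine Continuous.continuousAt ?_
    refine (Complex.continuous_ofReal.comp ((h.continuous_numer s).comp Complex.continuous_re)).mul
      (Continuous.inv₀ (by fun_prop) fun z => sub_mul_I_ne_zero hs _)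

theorem tendsto_regIntegrand_atInfty {s : ℝ} (hs : s ≠ 0) :
    Tendsto (fun z => regIntegrand v z s) atInfty (𝓝 0) := by
  refine tendsto_mul_atInfty (N := fun x => (numer v x s : ℂ))
    (D := fun y => ((s : ℂ) - y * Complex.I)⁻¹) (A := 2 * ψ 0) ?_ (fun x => ?_) ?_
    (norm_inv_sub_mul_I_le hs)
  · rw [← Complex.ofReal_zero]
    refine (Complex.continuous_ofReal.tendsto 0).comp ?_
    have h1 : Tendsto (fun x => v (x + s)) (cobounded ℝ) (𝓝 0) := by
      refine h.tendsto_zero.comp ?_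
      refine tendsto_norm_atTop_iff_cobounded.1 ?_
      have h2 : Tendsto (fun x : ℝ => ‖x‖ - ‖s‖) (cobounded ℝ) atTop :=
        tendsto_atTop_add_const_right _ _ tendsto_norm_cobounded_atTop
      refine tendsto_atTop_mono (fun x => ?_) h2
      simpa using norm_sub_norm_le x (-s)
    simp only [numer]
    split_ifs
    · simpa using h1.sub h.tendsto_zero
    · simpa using h1
  · rw [Complex.norm_real, Real.norm_eq_abs, numer]
    have h0 := h.psi_nonneg le_rfl
    split_ifs
    · exact (abs_sub _ _).trans (by linarith [h.bound (x + s), h.bound x])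
    · rw [sub_zero]; linarith [h.bound (x + s)]
  · refine tendsto_inv₀_cobounded.comp (tendsto_norm_atTop_iff_cobounded.1 ?_)
    refine tendsto_atTop_mono (fun y => ?_) tendsto_id
    have := Complex.abs_im_le_norm ((s : ℂ) - y * Complex.I)
    simp at this
    exact (le_abs_self y).trans this

theorem tendsto_regCauchy_atInfty : Tendsto (regCauchy v) atInfty (𝓝 0) := by
  -- `T z` is where the uniform majorant fails. There the variable `t = x + s` is used instead: `|s|
  -- ≥ 1` and `|t| < |s|/2` give `1 + |t| ≤ 2|s|`, hence the majorant `2ψ(|t|)/(1 + |t|)`.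
  set T : ℂ → Set ℝ := fun z => {s | 1 ≤ |s| ∧ |z.re + s| < |s| / 2} with hT
  have hTm : ∀ z, MeasurableSet (T z) := fun z =>
    (measurableSet_le measurable_const measurable_norm).inter
      (measurableSet_lt (measurable_const_add z.re).norm (measurable_norm.div_const 2))
  have hsplit : ∀ z, regCauchy v z = (∫ s, (T z)ᶜ.indicator (regIntegrand v z) s) +
      ∫ t, (T z).indicator (regIntegrand v z) (t - z.re) := by
    intro z
    rw [integral_sub_right_eq_self (fun s => (T z).indicator (regIntegrand v z) s) z.re,
      ← integral_add ((h.integrable_regIntegrand z).indicator (hTm z).compl)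
        ((h.integrable_regIntegrand z).indicator (hTm z)), regCauchy]
    refine integral_congr_ae (Eventually.of_forall fun s => ?_)
    exact (congrFun (Set.indicator_compl_add_self (T z) (regIntegrand v z)) s).symm
  have h1 : Tendsto (fun z => ∫ s, (T z)ᶜ.indicator (regIntegrand v z) s) atInfty
      (𝓝 (∫ _ : ℝ, (0 : ℂ))) := by
    refine tendsto_integral_filter_of_dominated_convergence _
      (Eventually.of_forall fun z =>
        ((h.measurable_regIntegrand z).indicator (hTm z).compl).aestronglyMeasurable)
      (Eventually.of_forall fun z => ae_ne_zero.mono fun s hs => ?_) h.majorant_int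
      (ae_ne_zero.mono fun s hs => squeeze_zero_norm (fun z => norm_indicator_le_norm_self _ _)
        (tendsto_zero_iff_norm_tendsto_zero.1 (h.tendsto_regIntegrand_atInfty hs)))
    by_cases hsT : s ∈ T z
    · rw [Set.indicator_of_notMem (by simpa using hsT), norm_zero]
      have := h.g_nonneg s
      have := h.psi_nonneg (abs_nonneg (s / 2))
      positivity
    · rw [Set.indicator_of_mem (by simpa using hsT)]
      refine h.norm_regIntegrand_le hs ?_
      by_contra! hc
      exact hsT hc
  have hval : ∀ z : ℂ, ∀ t : ℝ, t - z.re ∈ T z →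
      regIntegrand v z (t - z.re) = v t * ((t : ℂ) - z)⁻¹ := by
    intro z t ht
    rw [regIntegrand, numer, if_neg ht.1.not_gt, sub_zero, add_sub_cancel]
    congr 2
    conv_rhs => rw [← Complex.re_add_im z]
    push_cast
    ring
  have h2 : Tendsto (fun z => ∫ t, (T z).indicator (regIntegrand v z) (t - z.re)) atInfty
      (𝓝 (∫ _ : ℝ, (0 : ℂ))) := by
    refine tendsto_integral_filter_of_dominated_convergence
      (fun t => 2 * (ψ |t| / (1 + |t|)))
      (Eventually.of_forall fun z => (((h.measurable_regIntegrand z).indicator (hTm z)).comp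
        (measurable_sub_const _)).aestronglyMeasurable)
      (Eventually.of_forall fun z => Eventually.of_forall fun t => ?_) (h.psi_int.const_mul 2)
      (Eventually.of_forall fun t => ?_)
    · by_cases ht : t - z.re ∈ T z
      · rw [Set.indicator_of_mem ht, regIntegrand, norm_mul, Complex.norm_real, Real.norm_eq_abs,
          numer, if_neg ht.1.not_gt, sub_zero, add_sub_cancel, div_eq_mul_inv, mul_left_comm]
        have h3 := ht.2
        have h4 := ht.1
        rw [add_sub_cancel] at h3
        refine mul_le_mul (h.le_psi t) ((norm_inv_sub_mul_I_le ?_ _).trans ?_) (norm_nonneg _)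
          (h.psi_nonneg (abs_nonneg t))
        · exact abs_pos.1 (by linarith)
        · rw [inv_le_iff_one_le_mul₀ (by linarith), mul_assoc, inv_mul_eq_div, ← mul_div_assoc,
            one_le_div (by positivity)]
          linarith
      · rw [Set.indicator_of_notMem ht, norm_zero]
        have := h.psi_nonneg (abs_nonneg t)
        positivity
    · refine squeeze_zero_norm (a := fun z : ℂ => ‖(v t : ℂ) * ((t : ℂ) - z)⁻¹‖) (fun z => ?_) ?_
      · by_cases ht : t - z.re ∈ T z
        · rw [Set.indicator_of_mem ht, hval z t ht]
        · rw [Set.indicator_of_notMem ht, norm_zero]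
          exact norm_nonneg _
      · have h5 : Tendsto (fun z : ℂ => ((t : ℂ) - z)⁻¹) atInfty (𝓝 0) := by
          refine tendsto_inv₀_cobounded.comp (tendsto_norm_atTop_iff_cobounded.1 ?_)
          have h6 : Tendsto (fun z : ℂ => ‖z‖ - ‖(t : ℂ)‖) atInfty atTop :=
            tendsto_atTop_add_const_right _ _ (tendsto_norm_cobounded_atTop.mono_left inf_le_left)
          refine tendsto_atTop_mono (fun z => ?_) h6
          rw [norm_sub_rev]
          exact norm_sub_norm_le _ _
        simpa using (h5.const_mul (v t : ℂ)).norm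
  have h3 := h1.add h2
  simp only [integral_zero, add_zero] at h3
  exact h3.congr fun z => (hsplit z).symm

end DiniMajorants

end SchwarzIntegral

/-! ### Boundary jump and continuous extension of the Schwarz integral -/

namespace SchwarzIntegral

/-- The right side extends continuously to `y = 0` with value `iπ`; this is the Sokhotski–Plemelj
jump. -/
theorem integral_inv_sub_mul_I {y : ℝ} (hy : 0 < y) :
    ∫ s : ℝ in (-1)..1, ((s : ℂ) - y * Complex.I)⁻¹ =
      Complex.I * (Real.pi - 2 * Real.arctan y : ℝ) := by
  have hne : ∀ s : ℝ, (s : ℂ) - y * Complex.I ≠ 0 := fun s =>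
    ofReal_sub_ne_zero (z := y * Complex.I) (by simpa using hy) s
  have hcont : Continuous fun s : ℝ => ((s : ℂ) - y * Complex.I)⁻¹ :=
    Continuous.inv₀ (by fun_prop) hne
  have hd : ∀ s : ℝ, HasDerivAt (fun s : ℝ => ((1 / 2 * Real.log (s ^ 2 + y ^ 2) : ℝ) : ℂ) +
      Complex.I * ((Real.arctan (s / y) : ℝ) : ℂ)) (((s : ℂ) - y * Complex.I)⁻¹) s := by
    intro s
    have hpos : s ^ 2 + y ^ 2 ≠ 0 := by positivity
    have h1 : HasDerivAt (fun s : ℝ => 1 / 2 * Real.log (s ^ 2 + y ^ 2)) (s / (s ^ 2 + y ^ 2)) s :=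
      (((((hasDerivAt_id s).pow 2).add_const (y ^ 2)).log hpos).const_mul (1 / 2)).congr_deriv
        (by simp; field_simp)
    have h2 : HasDerivAt (fun s : ℝ => Real.arctan (s / y)) (y / (s ^ 2 + y ^ 2)) s :=
      (((hasDerivAt_id s).div_const y).arctan).congr_deriv (by simp; field_simp; exact add_comm _ _)
    refine (h1.ofReal_comp.add (h2.ofReal_comp.const_mul Complex.I)).congr_deriv ?_
    have hc : (s : ℂ) ^ 2 + (y : ℂ) ^ 2 ≠ 0 := by exact_mod_cast hpos
    have h3 := hne s
    push_cast
    rw [← mul_div_assoc, ← add_div, div_eq_iff hc, eq_comm, inv_mul_eq_iff_eq_mul₀ h3]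
    linear_combination (y : ℂ) ^ 2 * Complex.I_sq
  rw [intervalIntegral.integral_eq_sub_of_hasDerivAt (fun s _ => hd s)
    (hcont.intervalIntegrable _ _)]
  have h4 : Real.arctan (1 / y) = Real.pi / 2 - Real.arctan y := by
    rw [one_div, Real.arctan_inv_of_pos hy]
  rw [neg_div, Real.arctan_neg, h4, neg_one_sq, one_pow]
  push_cast
  ring

namespace DiniMajorants

variable {v g ψ : ℝ → ℝ} (h : DiniMajorants v g ψ)

include h

/-- Translate by `x` and add back the value `v(x)` that the regularisation removed on `|s| < 1`. -/
theorem cauchy_eq {z : ℂ} (hz : 0 < z.im) :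
    Integrable (fun t : ℝ => (v t : ℂ) * ((t : ℂ) - z)⁻¹) ∧
      ∫ t : ℝ, (v t : ℂ) * ((t : ℂ) - z)⁻¹ = regCauchy v z +
        v z.re * (Complex.I * (Real.pi - 2 * Real.arctan z.im : ℝ)) := by
  set K : ℝ → ℂ := fun s => ((s : ℂ) - z.im * Complex.I)⁻¹ with hK
  have hKc : Continuous K := Continuous.inv₀ (by fun_prop) fun s =>
    ofReal_sub_ne_zero (z := z.im * Complex.I) (by simpa using hz) s
  have hKi : IntegrableOn K (Set.Ioo (-1) 1) :=
    (hKc.integrableOn_Icc (a := -1) (b := 1)).mono_set Set.Ioo_subset_Icc_self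
  have h1 : ∀ s, (v (z.re + s) : ℂ) * K s =
      regIntegrand v z s + v z.re * (Set.Ioo (-1) 1).indicator K s := by
    intro s
    by_cases hs : |s| < 1
    · rw [Set.indicator_of_mem (Set.mem_Ioo.2 (abs_lt.1 hs)), regIntegrand, numer, if_pos hs]
      push_cast
      ring
    · rw [Set.indicator_of_notMem (fun h' : s ∈ Set.Ioo (-1 : ℝ) 1 => hs (abs_lt.2 h')), regIntegrand, numer, if_neg hs]
      simp [hK]
  have hi2 : Integrable ((Set.Ioo (-1) 1).indicator K) :=
    (integrable_indicator_iff measurableSet_Ioo).2 hKi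
  have hi : Integrable fun s => (v (z.re + s) : ℂ) * K s :=
    ((h.integrable_regIntegrand z).add (hi2.const_mul (v z.re : ℂ))).congr
      (Eventually.of_forall fun s => (h1 s).symm)
  have h2 : ∀ t : ℝ, (v (z.re + (t - z.re)) : ℂ) * K (t - z.re) =
      (v t : ℂ) * ((t : ℂ) - z)⁻¹ := by
    intro t
    rw [add_sub_cancel]
    simp only [hK]
    congr 2
    conv_rhs => rw [← Complex.re_add_im z]
    push_cast
    ring
  constructor
  · exact (hi.comp_sub_right z.re).congr (Eventually.of_forall h2)
  · rw [← integral_congr_ae (Eventually.of_forall h2),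
      integral_sub_right_eq_self (fun s => (v (z.re + s) : ℂ) * K s) z.re,
      integral_congr_ae (Eventually.of_forall h1),
      integral_add (h.integrable_regIntegrand z) (hi2.const_mul (v z.re : ℂ)), integral_const_mul,
      integral_indicator measurableSet_Ioo, ← integral_Ioc_eq_integral_Ioo,
      ← intervalIntegral.integral_of_le (by norm_num), integral_inv_sub_mul_I hz, regCauchy]

theorem schwarz_eq {z : ℂ} (hz : 0 < z.im) :
    schwarz v z = (Real.pi * Complex.I)⁻¹ * (regCauchy v z +
      v z.re * (Complex.I * (Real.pi - 2 * Real.arctan z.im : ℝ)) -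
        (∫ t, v t * (t / (t ^ 2 + 1)) : ℝ)) := by
  obtain ⟨hi, he⟩ := h.cauchy_eq hz
  have hk := integrable_mul_kernel h.cont h.bound hz
  have h1 : ∀ t : ℝ, (v t : ℂ) * ((t : ℂ) - z)⁻¹ - v t * kernel z t =
      ((v t * (t / (t ^ 2 + 1)) : ℝ) : ℂ) := by
    intro t
    rw [kernel]
    push_cast
    ring
  have h2 := integral_sub hi hk
  rw [integral_congr_ae (Eventually.of_forall h1), integral_complex_ofReal, he] at h2
  rw [schwarz, h2]
  ring

end DiniMajorants

theorem schwarz_sub_const {u : ℝ → ℝ} {M : ℝ} (hu : Continuous u) (hM : ∀ t, |u t| ≤ M) (c : ℝ)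
    {z : ℂ} (hz : 0 < z.im) : schwarz u z = c + schwarz (fun t => u t - c) z := by
  have h1 := integrable_mul_kernel hu hM hz
  have h2 := (integrable_mul_kernel (u := fun _ => 1) (M := 1) continuous_const (by simp)
    hz).const_mul (c : ℂ)
  have h3 := schwarz_one hz
  have h4 : schwarz (fun t => u t - c) z = schwarz u z - c * schwarz (fun _ => 1) z := by
    have h5 : ∀ t, ((u t - c : ℝ) : ℂ) * kernel z t =
        u t * kernel z t - c * (((1 : ℝ) : ℂ) * kernel z t) := by
      intro t
      push_cast
      ring
    simp only [schwarz]
    rw [integral_congr_ae (Eventually.of_forall h5), integral_sub h1 h2, integral_const_mul]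
    ring
  rw [h4, h3]
  ring

/-- Boundary behaviour of the Schwarz integral of a function of Dini class. -/
theorem exists_extension {u : ℝ → ℝ} {c : ℝ} {g ψ : ℝ → ℝ}
    (h : DiniMajorants (fun t => u t - c) g ψ) :
    ∃ G : ℂ → ℂ, Continuous G ∧ (∀ z, 0 < z.im → G z = schwarz u z) ∧
      (∀ x : ℝ, (G x).re = u x) ∧ ∃ L, Tendsto G atInfty (𝓝 L) := by
  have hu : Continuous u := (h.cont.add (continuous_const (y := c))).congr fun t => by simp
  have hM : ∀ t, |u t| ≤ ψ 0 + |c| := fun t => by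
    have h1 := h.bound t
    have h2 : |u t| ≤ |u t - c| + |c| := by simpa using abs_add_le (u t - c) c
    linarith
  set v : ℝ → ℝ := fun t => u t - c with hv
  set κ : ℝ := ∫ t, v t * (t / (t ^ 2 + 1))
  refine ⟨fun z => c + (Real.pi * Complex.I)⁻¹ * (regCauchy v z +
      v z.re * (Complex.I * (Real.pi - 2 * Real.arctan z.im : ℝ)) - κ), ?_, fun z hz => ?_,
      fun x => ?_, c + (Real.pi * Complex.I)⁻¹ * (0 + 0 - κ), ?_⟩
  · have h1 : Continuous fun z : ℂ => ((v z.re : ℝ) : ℂ) :=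
      Complex.continuous_ofReal.comp (h.cont.comp Complex.continuous_re)
    have h2 : Continuous fun z : ℂ => ((Real.pi - 2 * Real.arctan z.im : ℝ) : ℂ) :=
      Complex.continuous_ofReal.comp
        (continuous_const.sub (continuous_const.mul
          (Real.continuous_arctan.comp Complex.continuous_im)))
    exact continuous_const.add (continuous_const.mul
      ((h.continuous_regCauchy.add (h1.mul (continuous_const.mul h2))).sub continuous_const))
  · rw [schwarz_sub_const hu hM c hz, h.schwarz_eq hz]
  -- On the axis the regularised integral is real, as is `κ`, so division by `πi` makes both
  -- imaginary. Only `c` and the jump term `v(x)·iπ` contribute to the real part.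
  · have h1 : regCauchy v x = ((∫ s, numer v x s * s⁻¹ : ℝ) : ℂ) := by
      rw [regCauchy, ← integral_complex_ofReal]
      refine integral_congr_ae (Eventually.of_forall fun s => ?_)
      simp [regIntegrand]
    simp only [h1, Complex.ofReal_re, Complex.ofReal_im, Real.arctan_zero]
    have h2 : (Real.pi * Complex.I : ℂ)⁻¹ = ((-Real.pi⁻¹ : ℝ) : ℂ) * Complex.I := by
      push_cast
      field_simp
      simp
    rw [h2]
    simp [hv]
    field_simp [Real.pi_ne_zero]
    ring
  · have h1 : Tendsto (fun z : ℂ => (v z.re : ℂ) *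
        (Complex.I * (Real.pi - 2 * Real.arctan z.im : ℝ))) atInfty (𝓝 0) := by
      refine tendsto_mul_atInfty (N := fun x => (v x : ℂ))
        (D := fun y => Complex.I * (Real.pi - 2 * Real.arctan y : ℝ)) (A := ψ 0)
        (B := 2 * Real.pi) ?_ (fun x => ?_) ?_ (fun y => ?_)
      · rw [← Complex.ofReal_zero]
        exact (Complex.continuous_ofReal.tendsto 0).comp h.tendsto_zero
      · rw [Complex.norm_real, Real.norm_eq_abs]
        exact h.bound x
      · have h3 : Tendsto Real.arctan atTop (𝓝 (Real.pi / 2)) :=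
          Real.tendsto_arctan_atTop.mono_right nhdsWithin_le_nhds
        have h4 : Tendsto (fun y => Real.pi - 2 * Real.arctan y) atTop (𝓝 0) := by
          have := (h3.const_mul 2).const_sub Real.pi
          rwa [mul_div_cancel₀ _ two_ne_zero, sub_self] at this
        have h5 := ((Complex.continuous_ofReal.tendsto 0).comp h4).const_mul Complex.I
        simpa only [Complex.ofReal_zero, mul_zero, Function.comp_def] using h5
      · rw [norm_mul, Complex.norm_I, one_mul, Complex.norm_real, Real.norm_eq_abs, abs_le]
        have := Real.arctan_lt_pi_div_two y
        have := Real.neg_pi_div_two_lt_arctan y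
        constructor <;> linarith [Real.pi_pos]
    exact (((h.tendsto_regCauchy_atInfty.add h1).sub_const _).const_mul _).const_add _

/-! ### Holomorphic functions in the upper half-plane -/

/-- Cauchy's estimate on the disc of radius `y/2`, which stays in the half-plane; the factor `y`
cancels the radius. -/
theorem norm_im_mul_deriv_le {G : ℂ → ℂ} (hd : DifferentiableOn ℂ G {z | 0 < z.im}) {z c : ℂ}
    (hz : 0 < z.im) {ε : ℝ} (hε : ∀ w : ℂ, 0 < w.im → ‖w - z‖ ≤ z.im / 2 → ‖G w - c‖ ≤ ε) :
    ‖(z.im : ℂ) * deriv G z‖ ≤ 2 * ε := by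
  have hball : ∀ w ∈ Metric.closedBall z (z.im / 2), 0 < w.im := by
    intro w hw
    rw [mem_closedBall_iff_norm] at hw
    have := (Complex.abs_im_le_norm (w - z)).trans hw
    rw [Complex.sub_im, abs_le] at this
    linarith [this.1]
  have hd' : DiffContOnCl ℂ (fun w => G w - c) (Metric.ball z (z.im / 2)) := by
    refine DifferentiableOn.diffContOnCl ?_
    rw [closure_ball _ (half_pos hz).ne']
    exact (hd.mono hball).sub_const c
  have h := Complex.norm_deriv_le_of_forall_mem_sphere_norm_le (half_pos hz) hd'
    (C := ε) fun w hw => hε w (hball w (Metric.sphere_subset_closedBall hw))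
      (mem_sphere_iff_norm.1 hw).le
  rw [deriv_sub_const_fun] at h
  rw [norm_mul, Complex.norm_real, Real.norm_of_nonneg hz.le]
  rw [le_div_iff₀ (half_pos hz)] at h
  linarith

theorem continuousOn_im_mul_deriv {G : ℂ → ℂ} (hd : DifferentiableOn ℂ G {z | 0 < z.im})
    (hc : ContinuousOn G {z | 0 ≤ z.im}) :
    ContinuousOn (fun z => (z.im : ℂ) * deriv G z) {z | 0 ≤ z.im} := by
  intro z₀ hz₀
  rcases (show (0 : ℝ) ≤ z₀.im from hz₀).lt_or_eq with h0 | h0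
  · have h1 : ContinuousAt (deriv G) z₀ :=
      ((hd.deriv im_pos_isOpen).continuousOn).continuousAt (im_pos_isOpen.mem_nhds h0)
    exact ((Complex.continuous_ofReal.comp Complex.continuous_im).continuousAt.mul
      h1).continuousWithinAt
  · rw [Metric.continuousWithinAt_iff]
    intro ε hε
    obtain ⟨δ, hδ, H⟩ := Metric.continuousWithinAt_iff.1 (hc z₀ hz₀) (ε / 3) (by positivity)
    refine ⟨δ / 2, by positivity, fun z hz hzd => ?_⟩
    rw [← h0, Complex.ofReal_zero, zero_mul, dist_zero_right]
    rcases (show (0 : ℝ) ≤ z.im from hz).lt_or_eq with h1 | h1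
    · have h2 : z.im ≤ dist z z₀ := by
        rw [dist_eq_norm]
        have := Complex.abs_im_le_norm (z - z₀)
        rw [Complex.sub_im, ← h0, sub_zero] at this
        exact (le_abs_self _).trans this
      have := norm_im_mul_deriv_le hd (c := G z₀) h1 (ε := ε / 3) fun w hw hwz => by
        rw [← dist_eq_norm] at hwz ⊢
        refine (H (show (0 : ℝ) ≤ w.im from hw.le) ?_).le
        linarith [dist_triangle w z z₀]
      linarith
    · rw [← h1]
      simpa using hε

theorem tendsto_im_mul_deriv {G : ℂ → ℂ} (hd : DifferentiableOn ℂ G {z | 0 < z.im}) {L : ℂ}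
    (hL : Tendsto G atInfty (𝓝 L)) :
    Tendsto (fun z => (z.im : ℂ) * deriv G z) atInfty (𝓝 0) := by
  rw [Metric.tendsto_nhds]
  intro ε hε
  have h1 := Metric.tendsto_nhds.1 hL (ε / 3) (by positivity)
  rw [atInfty, eventually_inf_principal, ← comap_norm_atTop, eventually_comap,
    eventually_atTop] at h1
  obtain ⟨R, hR⟩ := h1
  rw [atInfty, eventually_inf_principal, ← comap_norm_atTop, eventually_comap]
  -- Points of the disc satisfy `|w| ≥ |z| - y/2 ≥ |z|/2 ≥ R`.
  filter_upwards [eventually_ge_atTop (2 * R)] with r hr z hzr hz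
  rw [dist_zero_right]
  rcases (show (0 : ℝ) ≤ z.im from hz).lt_or_eq with h1 | h1
  · have := norm_im_mul_deriv_le hd (c := L) h1 (ε := ε / 3) fun w hw hwz => by
      rw [← dist_eq_norm]
      refine (hR ‖w‖ ?_ w rfl hw.le).le
      have h2 := norm_sub_norm_le z w
      rw [norm_sub_rev] at h2
      have h3 := (le_abs_self _).trans (Complex.abs_im_le_norm z)
      linarith
    linarith
  · rw [← h1]
    simpa using hε

/-- Since `|exp F| = exp (Re F)` equals `1` on the axis and `exp F` is bounded near infinity,
Phragmén–Lindelöf gives `|exp F| ≤ 1`. The rotation by `i` moves the problem to the right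
half-plane. -/
theorem re_nonpos_of_boundary {F : ℂ → ℂ} (hd : DifferentiableOn ℂ F {z | 0 < z.im})
    (hc : ContinuousOn F {z | 0 ≤ z.im}) {L : ℂ}
    (hL : Tendsto F (cobounded ℂ ⊓ 𝓟 {z | 0 < z.im}) (𝓝 L))
    (hF : ∀ x : ℝ, (F x).re = 0) {z : ℂ} (hz : 0 ≤ z.im) : (F z).re ≤ 0 := by
  set f : ℂ → ℂ := fun w => Complex.exp (F (Complex.I * w)) with hf
  have him : ∀ w : ℂ, (Complex.I * w).im = w.re := fun w => by simp
  have hT : Tendsto f (cobounded ℂ ⊓ 𝓟 {w | 0 < w.re}) (𝓝 (Complex.exp L)) := by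
    refine (Complex.continuous_exp.tendsto L).comp (hL.comp ?_)
    refine tendsto_inf.2 ⟨tendsto_inf_left (tendsto_norm_atTop_iff_cobounded.1 ?_),
      tendsto_inf_right (tendsto_principal_principal.2 fun w hw => by
        simpa only [Set.mem_ofPred_eq, him] using hw)⟩
    simpa using tendsto_norm_cobounded_atTop (E := ℂ)
  have h := PhragmenLindelof.right_half_plane_of_bounded_on_real (f := f) (C := 1)
    (z := -Complex.I * z) ?_ ⟨1, by norm_num, 0, ?_⟩ ?_ (fun x => ?_) (by simpa using hz)
  · have h2 : Complex.I * (-Complex.I * z) = z := by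
      linear_combination -z * Complex.I_sq
    simp only [hf, h2, Complex.norm_exp, Real.exp_le_one_iff] at h
    exact h
  · refine ⟨fun w hw => ?_, ?_⟩
    · have h3 : DifferentiableAt ℂ F (Complex.I * w) :=
        hd.differentiableAt (im_pos_isOpen.mem_nhds (by simpa using hw))
      exact (h3.comp w (differentiableAt_id.const_mul Complex.I)).cexp.differentiableWithinAt
    · rw [Complex.closure_setOfPred_lt_re]
      refine Complex.continuous_exp.comp_continuousOn
        (hc.comp (continuous_const.mul continuous_id).continuousOn fun w hw => ?_)
      simpa using hw
  · simpa using hT.isBigO_one ℝ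
  · have h3 : Tendsto (fun x : ℝ => (x : ℂ)) atTop (cobounded ℂ ⊓ 𝓟 {w | 0 < w.re}) := by
      refine tendsto_inf.2 ⟨tendsto_norm_atTop_iff_cobounded.1 ?_, tendsto_principal.2 ?_⟩
      · simpa using tendsto_abs_atTop_atTop
      · filter_upwards [eventually_gt_atTop 0] with x hx
        simpa using hx
    exact (hT.comp h3).norm.isBoundedUnder_le
  · have h4 : Complex.I * (x * Complex.I) = ((-x : ℝ) : ℂ) := by
      push_cast
      linear_combination (x : ℂ) * Complex.I_sq
    simp only [hf, h4, Complex.norm_exp, hF, Real.exp_zero, le_refl]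

/-- A holomorphic function in the upper half-plane with a limit at infinity and purely imaginary
boundary values is constant. -/
theorem eq_const_of_boundary {F : ℂ → ℂ} (hd : DifferentiableOn ℂ F {z | 0 < z.im})
    (hc : ContinuousOn F {z | 0 ≤ z.im}) {L : ℂ}
    (hL : Tendsto F (cobounded ℂ ⊓ 𝓟 {z | 0 < z.im}) (𝓝 L))
    (hF : ∀ x : ℝ, (F x).re = 0) : ∃ a : ℝ, ∀ z : ℂ, 0 < z.im → F z = a * Complex.I := by
  have hre : ∀ z : ℂ, 0 < z.im → (F z).re = 0 := fun z hz => by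
    have h1 := re_nonpos_of_boundary hd hc hL hF hz.le
    have h2 := re_nonpos_of_boundary (F := fun z => -F z) hd.neg hc.neg hL.neg
      (fun x => by simp [hF]) hz.le
    rw [Complex.neg_re] at h2
    linarith
  obtain ⟨a, ha⟩ := (hd.analyticOnNhd im_pos_isOpen).eq_re_add_const_mul_I_of_re_eq_const
    (c₀ := 0) hre im_pos_isOpen
    ⟨⟨Complex.I, by simp⟩, (convex_halfSpace_im_gt 0).isPreconnected⟩
  exact ⟨a, fun z hz => by simpa using ha z hz⟩

end SchwarzIntegral

namespace SchwarzIntegral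

/-! ### Dini conditions -/

theorem integrable_comp_abs {f : ℝ → ℝ} (hf : IntegrableOn f (Set.Ioi 0)) :
    Integrable fun x => f |x| := by
  have h1 : IntegrableOn (fun x => f |x|) (Set.Ioi 0) :=
    hf.congr_fun (fun x hx => by
      show f x = f |x|
      rw [abs_of_pos hx]) measurableSet_Ioi
  have h2 : IntegrableOn (fun x => f |x|) (Set.Iic 0) := by
    rw [integrableOn_Iic_iff_integrableOn_Iio, ← neg_zero (G := ℝ),
      ← (Measure.measurePreserving_neg (volume : Measure ℝ)).integrableOn_comp_preimage
        (Homeomorph.neg ℝ).measurableEmbedding]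
    simpa [Function.comp_def] using h1
  rw [← integrableOn_univ, ← Set.Iic_union_Ioi (a := (0 : ℝ))]
  exact h2.union h1

open Biharm

variable {u : ℝ → ℝ} {c M : ℝ}

theorem le_modulus {s t ε : ℝ} (h : |s - t| ≤ ε) : ENNReal.ofReal |u s - u t| ≤ modulus u ε :=
  le_iSup_of_le s (le_iSup_of_le t (le_iSup_of_le h le_rfl))

theorem modulus_mono : Monotone (modulus u) := fun _ _ h =>
  iSup_le fun _ => iSup_le fun _ => iSup_le fun h' => le_modulus (h'.trans h)

theorem modulus_ne_top (hM : ∀ t, |u t| ≤ M) (ε : ℝ) : modulus u ε ≠ ∞ := by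
  refine ne_top_of_le_ne_top (ENNReal.ofReal_ne_top (r := 2 * M)) ?_
  refine iSup_le fun s => iSup_le fun t => iSup_le fun _ => ENNReal.ofReal_le_ofReal ?_
  exact (abs_sub _ _).trans (by linarith [hM s, hM t])

/-- The form in the variable `r = 1/ε`. Since `1 / 0 = 0`, it also covers `r = 0`, where the
supremum runs over the whole line. -/
theorem modulusInfty_one_div (u : ℝ → ℝ) (c r : ℝ) :
    modulusInfty u c (1 / r) = ⨆ (t : ℝ) (_ : r ≤ |t|), ENNReal.ofReal |u t - c| := by
  simp only [modulusInfty, one_div_one_div]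

theorem modulusInfty_antitone : Antitone fun r => modulusInfty u c (1 / r) := fun r r' h => by
  simp only [modulusInfty_one_div]
  exact iSup_le fun t => iSup_le fun h' => le_iSup_of_le t (le_iSup_of_le (h.trans h') le_rfl)

theorem modulusInfty_ne_top (hM : ∀ t, |u t| ≤ M) (r : ℝ) : modulusInfty u c (1 / r) ≠ ∞ := by
  rw [modulusInfty_one_div]
  refine ne_top_of_le_ne_top (ENNReal.ofReal_ne_top (r := M + |c|)) ?_
  refine iSup_le fun t => iSup_le fun _ => ENNReal.ofReal_le_ofReal ?_
  exact (abs_sub _ _).trans (by linarith [hM t])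

theorem lintegral_inv_eq_top : ∫⁻ η in Set.Ioc (0 : ℝ) 1, ENNReal.ofReal η⁻¹ = ∞ := by
  by_contra h
  have h1 : IntegrableOn (fun η : ℝ => η⁻¹) (Set.Ioc 0 1) := by
    refine ⟨measurable_inv.aestronglyMeasurable, ?_⟩
    rw [hasFiniteIntegral_iff_ofReal]
    · exact lt_top_iff_ne_top.2 h
    · exact (ae_restrict_mem measurableSet_Ioc).mono fun η hη => (inv_pos.2 hη.1).le
  have h2 := (intervalIntegrable_iff_integrableOn_Ioc_of_le zero_le_one).2 h1
  rw [intervalIntegrable_inv_iff] at h2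
  simp at h2

/-- If the modulus stayed above `ε`, the Dini integral would dominate the divergent `ε ∫ dη/η`. -/
theorem exists_modulus_lt (hD : Dini (modulus u)) {ε : ℝ} (hε : 0 < ε) :
    ∃ η, 0 < η ∧ modulus u η < ENNReal.ofReal ε := by
  by_contra! h
  refine hD.ne (top_le_iff.1 ?_)
  calc (∞ : ℝ≥0∞) = ENNReal.ofReal ε * ∫⁻ η in Set.Ioc (0 : ℝ) 1, ENNReal.ofReal η⁻¹ := by
        rw [lintegral_inv_eq_top, ENNReal.mul_top (by simpa using hε)]
    _ = ∫⁻ η in Set.Ioc (0 : ℝ) 1, ENNReal.ofReal ε * ENNReal.ofReal η⁻¹ :=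
        (lintegral_const_mul' _ _ ENNReal.ofReal_ne_top).symm
    _ ≤ _ := by
        refine setLIntegral_mono' measurableSet_Ioc fun η hη => ?_
        rw [ENNReal.ofReal_inv_of_pos hη.1, div_eq_mul_inv]
        gcongr
        exact h η hη.1

theorem continuous_of_dini (hD : Dini (modulus u)) : Continuous u := by
  rw [Metric.continuous_iff]
  intro b ε hε
  obtain ⟨η, hη, hlt⟩ := exists_modulus_lt hD hε
  refine ⟨η, hη, fun a ha => ?_⟩
  rw [Real.dist_eq] at ha ⊢
  exact (ENNReal.ofReal_lt_ofReal_iff hε).1 ((le_modulus ha.le).trans_lt hlt)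

theorem exists_bound (hu : Continuous u) (hlim : Tendsto u (cobounded ℝ) (𝓝 c)) :
    ∃ M, ∀ t, |u t| ≤ M := by
  have h1 : ∀ᶠ t in cobounded ℝ, |u t| ≤ |c| + 1 :=
    (hlim.abs.eventually (eventually_le_nhds (lt_add_one |c|)))
  rw [← comap_norm_atTop, eventually_comap, eventually_atTop] at h1
  obtain ⟨R, hR⟩ := h1
  obtain ⟨A, hA⟩ := (isCompact_Icc (a := -R) (b := R)).exists_bound_of_continuousOn hu.continuousOn
  refine ⟨max A (|c| + 1), fun t => ?_⟩
  by_cases ht : |t| ≤ R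
  · exact (hA t (abs_le.1 ht)).trans (le_max_left _ _)
  · exact (hR |t| (not_le.1 ht).le t rfl).trans (le_max_right _ _)

theorem modulus_integrable (hD : Dini (modulus u)) :
    IntegrableOn (fun r => (modulus u r).toReal / r) (Set.Ioc 0 1) := by
  have h1 := integrable_toReal_of_lintegral_ne_top (μ := volume.restrict (Set.Ioc (0 : ℝ) 1))
    (f := fun η => modulus u η / ENNReal.ofReal η)
    (modulus_mono.measurable.div ENNReal.measurable_ofReal).aemeasurable hD.ne
  refine IntegrableOn.congr_fun h1 (fun η hη => ?_) measurableSet_Ioc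
  rw [ENNReal.toReal_div, ENNReal.toReal_ofReal hη.1.le]

/-- The substitution `η = 1/r` preserves `dη/η` up to orientation. -/
theorem modulusInfty_integrable (hD : Dini (modulusInfty u c)) :
    IntegrableOn (fun r => (modulusInfty u c (1 / r)).toReal / r) (Set.Ioi 1) := by
  have h1 := lintegral_image_eq_lintegral_abs_deriv_mul (s := Set.Ioi (1 : ℝ))
    (f := fun r => r⁻¹) (f' := fun r => -(r ^ 2)⁻¹) measurableSet_Ioi
    (fun x hx => (hasDerivAt_inv (zero_lt_one.trans hx).ne').hasDerivWithinAt)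
    inv_injective.injOn (fun η => modulusInfty u c η / ENNReal.ofReal η)
  have hsub : (fun r : ℝ => r⁻¹) '' Set.Ioi 1 ⊆ Set.Ioc 0 1 := by
    rintro _ ⟨r, hr, rfl⟩
    exact ⟨inv_pos.2 (zero_lt_one.trans hr), inv_le_one_of_one_le₀ (le_of_lt hr)⟩
  have h2 := ((lintegral_mono_set hsub).trans_lt hD).ne
  rw [h1] at h2
  have hm : Measurable fun r : ℝ => modulusInfty u c r⁻¹ := by
    simpa only [one_div] using (modulusInfty_antitone (u := u) (c := c)).measurable
  have h3 := integrable_toReal_of_lintegral_ne_top ?_ h2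
  · refine IntegrableOn.congr_fun h3 (fun r hr => ?_) measurableSet_Ioi
    have hr0 : 0 < r := zero_lt_one.trans hr
    rw [ENNReal.toReal_mul, ENNReal.toReal_div, ENNReal.toReal_ofReal (abs_nonneg _),
      ENNReal.toReal_ofReal (inv_pos.2 hr0).le, abs_neg, abs_of_pos (by positivity), one_div]
    field_simp
  · refine Measurable.aemeasurable (Measurable.mul (by fun_prop) (hm.div (by fun_prop)))

theorem exists_diniMajorants (hlim : Tendsto u (cobounded ℝ) (𝓝 c)) (hD : Dini (modulus u))
    (hD' : Dini (modulusInfty u c)) : ∃ g ψ, DiniMajorants (fun t => u t - c) g ψ := by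
  have hu := continuous_of_dini hD
  obtain ⟨M, hM⟩ := exists_bound hu hlim
  have hanti : Antitone fun r => (modulusInfty u c (1 / r)).toReal := fun r r' h =>
    ENNReal.toReal_mono (modulusInfty_ne_top hM r) (modulusInfty_antitone h)
  -- The majorants are `g(s) = ω(|s|)/|s|`, cut off at `|s| = 1`, and `ψ(r) = ω_∞(1/r)`.
  refine ⟨fun s => (Set.Iio 1).indicator (fun r => (modulus u r).toReal / r) |s|,
    fun r => (modulusInfty u c (1 / r)).toReal, hu.sub continuous_const, ?_, fun x s hs => ?_,
    fun s => ?_, ?_, hanti, fun t => ?_, ?_⟩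
  · simpa using hlim.sub_const c
  · rw [Set.indicator_of_mem (Set.mem_Iio.2 hs)]
    rcases eq_or_ne s 0 with rfl | h0
    · simp
    · rw [div_mul_cancel₀ _ (abs_ne_zero.2 h0), sub_sub_sub_cancel_right]
      exact (ENNReal.ofReal_le_iff_le_toReal (modulus_ne_top hM _)).1 (le_modulus (by simp))
  · exact Set.indicator_apply_nonneg fun _ => by positivity
  · refine integrable_comp_abs ?_
    rw [IntegrableOn, integrable_indicator_iff measurableSet_Iio, IntegrableOn,
      Measure.restrict_restrict measurableSet_Iio]
    exact (modulus_integrable hD).mono_set fun r hr => ⟨hr.2, le_of_lt hr.1⟩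
  · refine (ENNReal.ofReal_le_iff_le_toReal (modulusInfty_ne_top hM _)).1 ?_
    rw [modulusInfty_one_div]
    exact le_iSup_of_le t (le_iSup_of_le le_rfl le_rfl)
  · refine integrable_comp_abs (f := fun r => (modulusInfty u c (1 / r)).toReal / (1 + r)) ?_
    have hm : Measurable fun r => (modulusInfty u c (1 / r)).toReal / (1 + r) :=
      hanti.measurable.div (measurable_const_add 1)
    rw [← Set.Ioc_union_Ioi_eq_Ioi (zero_le_one (α := ℝ))]
    refine IntegrableOn.union ?_ ?_
    · refine Integrable.mono' (g := fun _ => (modulusInfty u c (1 / 0)).toReal)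
        (integrableOn_const (by simp)) hm.aestronglyMeasurable
        ((ae_restrict_mem measurableSet_Ioc).mono fun r hr => ?_)
      have := hr.1
      rw [Real.norm_of_nonneg (by positivity)]
      refine (div_le_self ENNReal.toReal_nonneg (by linarith)).trans (hanti hr.1.le)
    · refine Integrable.mono' (modulusInfty_integrable hD') hm.aestronglyMeasurable
        ((ae_restrict_mem measurableSet_Ioi).mono fun r hr => ?_)
      have hr0 : 0 < r := zero_lt_one.trans hr
      rw [Real.norm_of_nonneg (by positivity)]
      gcongr
      linarith

end SchwarzIntegral

namespace Biharm

open SchwarzIntegral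

/-! ### The biharmonic algebra as the algebra of dual numbers -/

/-- The complex number `z` in the decomposition `z + w ρ`, where `ρ = e₂ - i` satisfies `ρ² = 0`. -/
def base (a : Biharm) : ℂ := a.re + Complex.I * a.im

theorem ext_base {a b : Biharm} (h1 : base a = base b) (h2 : a.im = b.im) : a = b := by
  refine QuadraticAlgebra.ext ?_ h2
  simpa [base, h2] using h1

@[simp] theorem base_add (a b : Biharm) : base (a + b) = base a + base b := by
  simp [base]; ring

@[simp] theorem base_sub (a b : Biharm) : base (a - b) = base a - base b := by
  simp [base]; ring

@[simp] theorem base_smul (c : ℂ) (a : Biharm) : base (c • a) = c * base a := by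
  simp [base]; ring

@[simp] theorem base_real_smul (c : ℝ) (a : Biharm) : base (c • a) = c * base a := by
  simp [base]; ring

@[simp] theorem base_mul (a b : Biharm) : base (a * b) = base a * base b := by
  simp [base]
  linear_combination (a.im * b.im) * Complex.I_sq

theorem im_mul_eq (a b : Biharm) : (a * b).im = base a * b.im + a.im * base b := by
  simp [base]; ring

@[simp] theorem base_e₁ : base e₁ = 1 := by
  simp [base, e₁, QuadraticAlgebra.re_one, QuadraticAlgebra.im_one]

@[simp] theorem im_e₁ : e₁.im = 0 := QuadraticAlgebra.im_one

@[simp] theorem base_e₂ : base e₂ = Complex.I := by simp [base, e₂]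

@[simp] theorem im_e₂ : e₂.im = 1 := rfl

/-- The element `z + w ρ`, as a function of `(z, w)`. -/
noncomputable def ofDual : ℂ × ℂ →L[ℂ] Biharm :=
  LinearMap.toContinuousLinearMap
    { toFun := fun p => ⟨p.1 - Complex.I * p.2, p.2⟩
      map_add' := fun p q => by ext <;> simp; ring
      map_smul' := fun c p => by ext <;> simp; ring }

@[simp] theorem base_ofDual (p : ℂ × ℂ) : base (ofDual p) = p.1 := by
  simp [base, ofDual]

@[simp] theorem im_ofDual (p : ℂ × ℂ) : (ofDual p).im = p.2 := rfl

theorem ofDual_base_im (a : Biharm) : ofDual (base a, a.im) = a := ext_base (by simp) (by simp)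

theorem continuous_im : Continuous fun a : Biharm => a.im :=
  (LinearMap.toContinuousLinearMap
    { toFun := fun a : Biharm => a.im
      map_add' := fun _ _ => rfl
      map_smul' := fun _ _ => rfl : Biharm →ₗ[ℂ] ℂ }).continuous

theorem continuous_base : Continuous base :=
  (LinearMap.toContinuousLinearMap
    { toFun := base
      map_add' := base_add
      map_smul' := base_smul : Biharm →ₗ[ℂ] ℂ }).continuous

theorem tendsto_iff {α : Type*} {l : Filter α} {f : α → Biharm} {d : Biharm} :
    Tendsto f l (𝓝 d) ↔ Tendsto (fun x => base (f x)) l (𝓝 (base d)) ∧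
      Tendsto (fun x => (f x).im) l (𝓝 d.im) := by
  refine ⟨fun h => ⟨(continuous_base.tendsto d).comp h, (continuous_im.tendsto d).comp h⟩,
    fun h => ?_⟩
  have h1 := (ofDual.continuous.tendsto (base d, d.im)).comp (h.1.prodMk_nhds h.2)
  rw [ofDual_base_im] at h1
  exact h1.congr fun x => ofDual_base_im (f x)

/-- In dual numbers `(z + wρ)⁻¹ = z⁻¹ - w z⁻² ρ`. -/
theorem inverse_eq {a : Biharm} (ha : base a ≠ 0) :
    Ring.inverse a = ofDual ((base a)⁻¹, -a.im * ((base a) ^ 2)⁻¹) := by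
  have h1 : base (1 : Biharm) = 1 := base_e₁
  suffices h : a * ofDual ((base a)⁻¹, -a.im * ((base a) ^ 2)⁻¹) = 1 by
    have hu : IsUnit a := IsUnit.of_mul_eq_one _ h
    rw [← mul_one (Ring.inverse a), ← h, Ring.inverse_mul_cancel_left _ _ hu]
  refine ext_base ?_ ?_
  · rw [base_mul, base_ofDual, h1, mul_inv_cancel₀ ha]
  · rw [im_mul_eq, im_ofDual, base_ofDual, QuadraticAlgebra.im_one]
    field_simp
    ring

/-- The point of the biharmonic plane with the complex coordinate `z`. -/
noncomputable def ptc (z : ℂ) : Biharm := pt z.re z.im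

@[simp] theorem base_ptc (z : ℂ) : base (ptc z) = z := by
  conv_rhs => rw [← Complex.re_add_im z]
  simp [ptc, pt]

@[simp] theorem im_ptc (z : ℂ) : (ptc z).im = z.im := by
  simp [ptc, pt]

theorem ptc_add (z w : ℂ) : ptc (z + w) = ptc z + ptc w := ext_base (by simp) (by simp)

theorem norm_ptc (z : ℂ) : ‖ptc z‖ = ‖z‖ := by
  have h : (ptc z).re = z.re := by simp [ptc, pt, e₁, e₂, QuadraticAlgebra.re_one]
  rw [norm_eq, h, im_ptc, Complex.norm_real, Complex.norm_real, Real.norm_eq_abs, Real.norm_eq_abs,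
    sq_abs, sq_abs, ← Complex.norm_eq_sqrt_sq_add_sq]

theorem pt_eq_ptc (x y : ℝ) : pt x y = ptc ⟨x, y⟩ := rfl

theorem continuous_ptc : Continuous ptc := by
  have : ptc = fun z : ℂ => ofDual (z, (z.im : ℂ)) := by
    funext z
    exact ext_base (by simp) (by simp)
  rw [this]
  exact ofDual.continuous.comp
    (continuous_id.prodMk (Complex.continuous_ofReal.comp Complex.continuous_im))

theorem isEmbedding_ptc : IsEmbedding ptc :=
  IsEmbedding.of_leftInverse base_ptc continuous_base continuous_ptc

theorem map_ptc : map ptc (𝓝[≠] 0) = 𝓝[plane \ {0}] 0 := by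
  have h0 : ptc 0 = 0 := by simp [ptc, pt]
  rw [isEmbedding_ptc.map_nhdsWithin_eq, h0]
  congr 1
  ext ζ
  constructor
  · rintro ⟨z, hz, rfl⟩
    refine ⟨⟨z.re, z.im, rfl⟩, fun h => hz ?_⟩
    rw [← h0] at h
    exact isEmbedding_ptc.injective h
  · rintro ⟨⟨x, y, rfl⟩, h⟩
    refine ⟨⟨x, y⟩, fun h' => h ?_, rfl⟩
    rw [pt_eq_ptc, show (⟨x, y⟩ : ℂ) = 0 from h']
    exact h0

/-! ### Monogenic functions -/

theorem hasMonogenicDerivAt_iff {Φ : Biharm → Biharm} {d : Biharm} {z : ℂ} :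
    HasMonogenicDerivAt Φ d (ptc z) ↔
      HasDerivAt (fun w => base (Φ (ptc w))) (base d) z ∧
      Tendsto (fun w : ℂ => ((Φ (ptc (z + w))).im - (Φ (ptc z)).im) * w⁻¹ -
        (base (Φ (ptc (z + w))) - base (Φ (ptc z))) * (w.im * (w ^ 2)⁻¹)) (𝓝[≠] 0) (𝓝 d.im) := by
  rw [HasMonogenicDerivAt, ← map_ptc, tendsto_map'_iff, tendsto_iff,
    hasDerivAt_iff_tendsto_slope_zero]
  refine and_congr (tendsto_congr' ?_) (tendsto_congr' ?_)
  · filter_upwards [self_mem_nhdsWithin] with w hw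
    have hw : w ≠ 0 := hw
    simp [inverse_eq (a := ptc w) (by simpa using hw), ptc_add, mul_comm]
  · filter_upwards [self_mem_nhdsWithin] with w hw
    have hw : w ≠ 0 := hw
    rw [Function.comp_apply, im_mul_eq, inverse_eq (a := ptc w) (by simpa using hw)]
    simp [ptc_add]
    ring

/-- This is the error left when the difference quotient of `yF'` is compared with `yF''` and the
cross term of the monogenic quotient. The factor `Im w / w` is bounded by `1`. -/
theorem tendsto_slope_remainder {F : ℂ → ℂ} (hF : DifferentiableOn ℂ F {z | 0 < z.im}) {z : ℂ}
    (hz : 0 < z.im) :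
    Tendsto (fun w : ℂ => (w.im * w⁻¹) * (deriv F (z + w) - w⁻¹ * (F (z + w) - F z)))
      (𝓝[≠] 0) (𝓝 0) := by
  have hmem := im_pos_isOpen.mem_nhds hz
  have h1 := hasDerivAt_iff_tendsto_slope_zero.1 (hF.differentiableAt hmem).hasDerivAt
  have h2 : Tendsto (fun w => deriv F (z + w)) (𝓝[≠] 0) (𝓝 (deriv F z)) := by
    have h3 : ContinuousAt (deriv F) (z + 0) := by
      rw [add_zero]
      exact (hF.deriv im_pos_isOpen).continuousOn.continuousAt hmem
    have h4 := (h3.tendsto.comp ((continuous_const_add z).tendsto 0)).mono_left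
      (nhdsWithin_le_nhds (s := {0}ᶜ))
    rwa [add_zero] at h4
  have h4 := h2.sub h1
  rw [sub_self] at h4
  refine isBoundedUnder_le_mul_tendsto_zero (isBoundedUnder_of ⟨1, fun w => ?_⟩) h4
  simp only [Function.comp_apply]
  rw [norm_mul, norm_inv, ← div_eq_mul_inv, Complex.norm_real, Real.norm_eq_abs]
  exact div_le_one_of_le₀ (Complex.abs_im_le_norm w) (norm_nonneg w)

/-- A function is monogenic in the half-plane iff it is `F + (y F' + G) ρ` with `F`, `G`
holomorphic. -/
theorem monogenicOn_iff {Φ : Biharm → Biharm} :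
    MonogenicOn Φ halfPlane ↔ DifferentiableOn ℂ (fun z => base (Φ (ptc z))) {z | 0 < z.im} ∧
      DifferentiableOn ℂ (fun z => (Φ (ptc z)).im -
        z.im * deriv (fun z => base (Φ (ptc z))) z) {z | 0 < z.im} := by
  set F : ℂ → ℂ := fun z => base (Φ (ptc z))
  set H : ℂ → ℂ := fun z => (Φ (ptc z)).im
  -- Given `F` holomorphic, the `ρ`-part of the monogenic quotient differs from the complex quotient
  -- of `H - yF'` by a quantity tending to `yF''`.
  have key : DifferentiableOn ℂ F {z | 0 < z.im} → ∀ z : ℂ, 0 < z.im → ∀ e : ℂ,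
      (Tendsto (fun w : ℂ => (H (z + w) - H z) * w⁻¹ - (F (z + w) - F z) * (w.im * (w ^ 2)⁻¹))
        (𝓝[≠] 0) (𝓝 e) ↔
      HasDerivAt (fun z => H z - z.im * deriv F z) (e - z.im * deriv (deriv F) z) z) := by
    intro hF z hz e
    have hmem := im_pos_isOpen.mem_nhds hz
    have h1 := hasDerivAt_iff_tendsto_slope_zero.1
      ((hF.deriv im_pos_isOpen).differentiableAt hmem).hasDerivAt
    have h2 := (h1.const_mul (z.im : ℂ)).add (tendsto_slope_remainder hF hz)
    rw [add_zero] at h2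
    rw [hasDerivAt_iff_tendsto_slope_zero]
    constructor
    · intro h
      refine (h.sub h2).congr' ?_
      filter_upwards [self_mem_nhdsWithin] with w hw
      simp only [smul_eq_mul, Complex.add_im, Complex.ofReal_add]
      ring
    · intro h
      have h3 := h.add h2
      rw [sub_add_cancel] at h3
      refine h3.congr' ?_
      filter_upwards [self_mem_nhdsWithin] with w hw
      simp only [smul_eq_mul, Complex.add_im, Complex.ofReal_add]
      ring
  constructor
  · intro h
    have h0 : ∀ z : ℂ, 0 < z.im → ∃ d, HasMonogenicDerivAt Φ d (ptc z) := fun z hz =>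
      h _ ⟨z.re, z.im, hz, rfl⟩
    have hF : DifferentiableOn ℂ F {z | 0 < z.im} := fun z hz => by
      obtain ⟨d, hd⟩ := h0 z hz
      exact (hasMonogenicDerivAt_iff.1 hd).1.differentiableAt.differentiableWithinAt
    refine ⟨hF, fun z hz => ?_⟩
    obtain ⟨d, hd⟩ := h0 z hz
    exact ((key hF z hz _).1 (hasMonogenicDerivAt_iff.1
      hd).2).differentiableAt.differentiableWithinAt
  · rintro ⟨hF, hG⟩ _ ⟨x, y, hy, rfl⟩
    have hmem := im_pos_isOpen.mem_nhds (show (⟨x, y⟩ : ℂ) ∈ {z : ℂ | 0 < z.im} from hy)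
    have hG' := (hG.differentiableAt hmem).hasDerivAt
    rw [pt_eq_ptc]
    set z : ℂ := ⟨x, y⟩
    refine ⟨ofDual (deriv F z, deriv (fun z => H z - z.im * deriv F z) z +
      z.im * deriv (deriv F) z), hasMonogenicDerivAt_iff.2 ⟨?_, ?_⟩⟩
    · rw [base_ofDual]
      exact (hF.differentiableAt hmem).hasDerivAt
    · refine (key hF z hy _).2 ?_
      rw [im_ofDual]
      simpa using hG'

/-! ### The Schwarz-type integral -/

theorem schwarzIntegrand_ptc (u : ℝ → ℝ) {z : ℂ} (hz : 0 < z.im) (t : ℝ) :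
    schwarzIntegrand u (ptc z) t =
      ofDual ((u t : ℂ) * kernel z t, z.im * ((u t : ℂ) * (((t : ℂ) - z) ^ 2)⁻¹)) := by
  have h1 := ofReal_sub_ne_zero hz t
  have h2 : (t : ℂ) ^ 2 + 1 ≠ 0 := by exact_mod_cast (by positivity : t ^ 2 + 1 ≠ 0)
  have h3 : base (t • e₁ - ptc z) ≠ 0 := by simpa using h1
  rw [schwarzIntegrand, inverse_eq h3]
  refine ext_base ?_ ?_
  · rw [base_ofDual, kernel_eq hz]
    simp
    field_simp
  · rw [im_ofDual, QuadraticAlgebra.im_smul, im_mul_eq]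
    simp
    field_simp
    ring

theorem hasPV_schwarzIntegrand {u : ℝ → ℝ} {M : ℝ} (hu : Continuous u) (hM : ∀ t, |u t| ≤ M)
    {z : ℂ} (hz : 0 < z.im) :
    HasPV (schwarzIntegrand u (ptc z)) (ofDual (∫ t, (u t : ℂ) * kernel z t,
      z.im * ∫ t, (u t : ℂ) * (((t : ℂ) - z) ^ 2)⁻¹)) := by
  have h1 := integrable_mul_kernel hu hM hz
  have h2 := (integrable_mul_inv_sq hu hM hz).const_mul (z.im : ℂ)
  have h3 : schwarzIntegrand u (ptc z) = fun t => ofDual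
      ((u t : ℂ) * kernel z t, z.im * ((u t : ℂ) * (((t : ℂ) - z) ^ 2)⁻¹)) :=
    funext (schwarzIntegrand_ptc u hz)
  have hi : Integrable (schwarzIntegrand u (ptc z)) := by
    rw [h3]
    exact ofDual.integrable_comp (h1.prodMk h2)
  refine ⟨fun R => hi.intervalIntegrable, ?_⟩
  have h4 := intervalIntegral_tendsto_integral hi tendsto_neg_atTop_atBot tendsto_id
  refine (congrArg (Tendsto _ _) (congrArg 𝓝 ?_)).mp h4
  rw [h3, ContinuousLinearMap.integral_comp_comm _ (h1.prodMk h2), integral_pair h1 h2,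
    integral_const_mul]

theorem hasPV_pv {f : ℝ → Biharm} {I : Biharm} (h : HasPV f I) : pv f = I := h.2.limUnder_eq

/-- The `ρ`-part of the integrand is `y` times the `z`-derivative of the kernel, so `S` is the
Taylor extension `s(z + yρ) = s + y s' ρ` of the scalar Schwarz integral. -/
theorem S_ptc {u : ℝ → ℝ} {M : ℝ} (hu : Continuous u) (hM : ∀ t, |u t| ≤ M)
    {z : ℂ} (hz : 0 < z.im) :
    S u (ptc z) = ofDual (schwarz u z, z.im * deriv (schwarz u) z) := by
  rw [S, hasPV_pv (hasPV_schwarzIntegrand hu hM hz), (hasDerivAt_schwarz hu hM hz).deriv, schwarz]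
  refine ext_base ?_ ?_
  · rw [base_smul, base_ofDual, base_ofDual, one_div]
  · rw [QuadraticAlgebra.im_smul, im_ofDual, im_ofDual, one_div, smul_eq_mul]
    ring

theorem solutionFormula_ptc {u₁ u₄ : ℝ → ℝ} {M₁ M₄ : ℝ} (hu₁ : Continuous u₁)
    (hM₁ : ∀ t, |u₁ t| ≤ M₁) (hu₄ : Continuous u₄) (hM₄ : ∀ t, |u₄ t| ≤ M₄) (a₁ a₂ : ℝ) {z : ℂ}
    (hz : 0 < z.im) :
    solutionFormula u₁ u₄ a₁ a₂ (ptc z) =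
      ofDual (schwarz u₁ z - schwarz u₄ z + Complex.I * (a₁ + a₂),
        z.im * (deriv (schwarz u₁) z - deriv (schwarz u₄) z) + Complex.I * schwarz u₄ z + a₂) := by
  rw [solutionFormula, S_ptc hu₁ hM₁ hz, S_ptc hu₄ hM₄ hz]
  refine ext_base ?_ ?_
  · simp
    linear_combination schwarz u₄ z * Complex.I_sq
  · simp only [QuadraticAlgebra.im_add, QuadraticAlgebra.im_smul, im_mul_eq]
    simp
    ring

/-! ### Solutions of the (1-4)-problem -/

theorem tendsto_base_atInfty : Tendsto base (cobounded Biharm ⊓ 𝓟 halfPlane) atInfty := by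
  have h1 : ∀ ζ ∈ halfPlane, ‖base ζ‖ = ‖ζ‖ ∧ 0 ≤ (base ζ).im := by
    rintro _ ⟨x, y, hy, rfl⟩
    rw [pt_eq_ptc, base_ptc, norm_ptc]
    exact ⟨rfl, hy.le⟩
  refine tendsto_inf.2 ⟨tendsto_norm_atTop_iff_cobounded.1 ?_, tendsto_principal.2 ?_⟩
  · refine (tendsto_norm_cobounded_atTop.mono_left inf_le_left).congr' ?_
    filter_upwards [mem_inf_of_right (mem_principal_self halfPlane)] with ζ hζ
    exact (h1 ζ hζ).1.symm
  · filter_upwards [mem_inf_of_right (mem_principal_self halfPlane)] with ζ hζ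
    exact (h1 ζ hζ).2

theorem tendsto_ptc_cobounded :
    Tendsto ptc (cobounded ℂ ⊓ 𝓟 {z | 0 < z.im}) (cobounded Biharm ⊓ 𝓟 halfPlane) := by
  refine tendsto_inf.2 ⟨tendsto_inf_left (tendsto_norm_atTop_iff_cobounded.1 ?_),
    tendsto_inf_right (tendsto_principal_principal.2 fun z hz => ⟨z.re, z.im, hz, rfl⟩)⟩
  simpa only [norm_ptc] using tendsto_norm_cobounded_atTop (E := ℂ)

/-- The scalar extensions replace the Schwarz integrals in the formula; `yF'` is given its limit `0`
on the axis, which the default value of `deriv` there cannot spoil because it is multiplied by `y =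
0`. -/
theorem exists_solution {u₁ u₄ : ℝ → ℝ} {c₁ c₄ : ℝ} {g₁ g₄ ψ₁ ψ₄ : ℝ → ℝ}
    (h₁ : DiniMajorants (fun t => u₁ t - c₁) g₁ ψ₁) (h₄ : DiniMajorants (fun t => u₄ t - c₄) g₄ ψ₄)
    {M₁ M₄ : ℝ} (hu₁ : Continuous u₁) (hM₁ : ∀ t, |u₁ t| ≤ M₁) (hu₄ : Continuous u₄)
    (hM₄ : ∀ t, |u₄ t| ≤ M₄) (a₁ a₂ : ℝ) :
    ∃ Φ : Biharm → Biharm, IsSolution14 u₁ u₄ Φ ∧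
      ∀ ζ ∈ halfPlane, Φ ζ = solutionFormula u₁ u₄ a₁ a₂ ζ := by
  obtain ⟨G₁, hc₁, hs₁, hr₁, L₁, hL₁⟩ := exists_extension h₁
  obtain ⟨G₄, hc₄, hs₄, hr₄, L₄, hL₄⟩ := exists_extension h₄
  have hd : ∀ {u : ℝ → ℝ} {M : ℝ} {G : ℂ → ℂ}, Continuous u → (∀ t, |u t| ≤ M) →
      (∀ z, 0 < z.im → G z = schwarz u z) → ∀ z : ℂ, 0 < z.im →
      DifferentiableAt ℂ G z ∧ deriv G z = deriv (schwarz u) z := by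
    intro u M G hu hM hG z hz
    have he : G =ᶠ[𝓝 z] schwarz u := by
      filter_upwards [im_pos_isOpen.mem_nhds hz] with w hw using hG w hw
    exact ⟨(hasDerivAt_schwarz hu hM hz).differentiableAt.congr_of_eventuallyEq he, he.deriv_eq⟩
  set F : ℂ → ℂ := fun z => G₁ z - G₄ z + Complex.I * (a₁ + a₂) with hF
  set H : ℂ → ℂ := fun z => z.im * deriv F z + (Complex.I * G₄ z + a₂) with hH
  have hFd : DifferentiableOn ℂ F {z | 0 < z.im} := fun z hz =>
    (((hd hu₁ hM₁ hs₁ z hz).1.sub (hd hu₄ hM₄ hs₄ z hz).1).add_const _).differentiableWithinAt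
  have hFc : Continuous F := (hc₁.sub hc₄).add continuous_const
  have hFL : Tendsto F atInfty (𝓝 (L₁ - L₄ + Complex.I * (a₁ + a₂))) :=
    (hL₁.sub hL₄).add_const _
  have hHc : ContinuousOn H {z | 0 ≤ z.im} :=
    (continuousOn_im_mul_deriv hFd hFc.continuousOn).add
      ((continuous_const.mul hc₄).add continuous_const).continuousOn
  have hHL : Tendsto H atInfty (𝓝 (0 + (Complex.I * L₄ + a₂))) :=
    (tendsto_im_mul_deriv hFd hFL).add ((hL₄.const_mul _).add_const _)
  have hbx : ∀ x : ℝ, base (pt x 0) = x := fun x => by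
    rw [pt_eq_ptc, base_ptc]
    rfl
  refine ⟨fun ζ => ofDual (F (base ζ), H (base ζ)), ⟨?_, ?_, fun x => ?_, fun x => ?_, ?_⟩, ?_⟩
  · refine ofDual.continuous.comp_continuousOn
      ((hFc.comp continuous_base).continuousOn.prodMk
        (hHc.comp continuous_base.continuousOn ?_))
    rintro _ ⟨x, y, hy, rfl⟩
    rw [pt_eq_ptc, base_ptc]
    exact hy
  · rw [monogenicOn_iff]
    simp only [base_ptc, base_ofDual, im_ofDual]
    refine ⟨hFd, ?_⟩
    simp only [hH, add_sub_cancel_left]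
    exact fun z hz => (((hd hu₄ hM₄ hs₄ z hz).1.const_mul _).add_const _).differentiableWithinAt
  · simp only [hbx, U₁]
    simp [ofDual, hF, hH, hr₁, hr₄]
  · simp only [hbx, U₄, im_ofDual]
    simp [hH, hr₄]
  · exact ⟨_, (ofDual.continuous.tendsto _).comp
      ((hFL.comp tendsto_base_atInfty).prodMk_nhds (hHL.comp tendsto_base_atInfty))⟩
  · rintro _ ⟨x, y, hy, rfl⟩
    rw [pt_eq_ptc]
    set z : ℂ := ⟨x, y⟩
    have hz : 0 < z.im := hy
    have hdF : deriv F z = deriv (schwarz u₁) z - deriv (schwarz u₄) z := by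
      rw [hF, deriv_add_const, deriv_fun_sub (hd hu₁ hM₁ hs₁ z hz).1 (hd hu₄ hM₄ hs₄ z hz).1,
        (hd hu₁ hM₁ hs₁ z hz).2, (hd hu₄ hM₄ hs₄ z hz).2]
    rw [solutionFormula_ptc hu₁ hM₁ hu₄ hM₄ a₁ a₂ hz]
    simp only [base_ptc, hH, hdF]
    simp only [hF, hs₁ z hz, hs₄ z hz, add_assoc]

theorem base_im_of_solution {u₁ u₄ : ℝ → ℝ} {Φ : Biharm → Biharm} (h : IsSolution14 u₁ u₄ Φ) :
    (ContinuousOn (fun z => base (Φ (ptc z))) {z | 0 ≤ z.im} ∧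
      ContinuousOn (fun z => (Φ (ptc z)).im) {z | 0 ≤ z.im}) ∧
    (∃ L, Tendsto (fun z => base (Φ (ptc z))) (cobounded ℂ ⊓ 𝓟 {z | 0 < z.im}) (𝓝 L)) ∧
    (∃ L, Tendsto (fun z => (Φ (ptc z)).im) (cobounded ℂ ⊓ 𝓟 {z | 0 < z.im}) (𝓝 L)) ∧
    (∀ x : ℝ, (base (Φ (ptc x))).re = u₁ x - u₄ x) ∧ ∀ x : ℝ, (Φ (ptc x)).im.im = u₄ x := by
  have hc : ContinuousOn (fun z => Φ (ptc z)) {z | 0 ≤ z.im} :=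
    h.continuousOn.comp continuous_ptc.continuousOn fun z hz => ⟨z.re, z.im, hz, rfl⟩
  obtain ⟨L, hL⟩ := h.limit_infty
  have hL' := tendsto_iff.1 (hL.comp tendsto_ptc_cobounded)
  have h1 : ∀ x : ℝ, (Φ (ptc x)).re.re = u₁ x := h.boundary₁
  have h4 : ∀ x : ℝ, (Φ (ptc x)).im.im = u₄ x := h.boundary₄
  refine ⟨⟨continuous_base.comp_continuousOn hc, continuous_im.comp_continuousOn hc⟩,
    ⟨_, hL'.1⟩, ⟨_, hL'.2⟩, fun x => ?_, h4⟩
  simp [base, h1, h4, sub_eq_add_neg]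

/-- Two solutions of the (1-4)-problem differ by a constant `a₁ i e₁ + a₂ e₂`. -/
theorem solution_sub_solution {u₁ u₄ : ℝ → ℝ} {Φ Ψ : Biharm → Biharm} (hΦ : IsSolution14 u₁ u₄ Φ)
    (hΨ : IsSolution14 u₁ u₄ Ψ) :
    ∃ a₁ a₂ : ℝ, ∀ ζ ∈ halfPlane, Φ ζ = Ψ ζ + a₁ • (Complex.I • e₁) + a₂ • e₂ := by
  obtain ⟨⟨hFc, hHc⟩, ⟨L, hL⟩, ⟨N, hN⟩, hFb, hHb⟩ := base_im_of_solution hΦ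
  obtain ⟨⟨hFc', hHc'⟩, ⟨L', hL'⟩, ⟨N', hN'⟩, hFb', hHb'⟩ := base_im_of_solution hΨ
  obtain ⟨hFd, hGd⟩ := monogenicOn_iff.1 hΦ.monogenicOn
  obtain ⟨hFd', hGd'⟩ := monogenicOn_iff.1 hΨ.monogenicOn
  obtain ⟨a, ha⟩ := eq_const_of_boundary (hFd.sub hFd') (hFc.sub hFc') (hL.sub hL')
    (fun x => by simp [hFb, hFb'])
  have hderiv : ∀ z : ℂ, 0 < z.im → deriv (fun z => base (Φ (ptc z))) z =
      deriv (fun z => base (Ψ (ptc z))) z := by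
    intro z hz
    have he : (fun z => base (Φ (ptc z))) =ᶠ[𝓝 z]
        fun z => base (Ψ (ptc z)) + a * Complex.I := by
      filter_upwards [im_pos_isOpen.mem_nhds hz] with w hw
      have := ha w hw
      simp only [Pi.sub_apply] at this
      rw [← this]
      ring
    rw [he.deriv_eq, deriv_add_const]
  -- With equal `F'` the `yF'` terms cancel, leaving a holomorphic difference. The factor `i` turns
  -- its vanishing imaginary part on the axis into a vanishing real part.
  have hKd : DifferentiableOn ℂ (fun z => Complex.I * ((Φ (ptc z)).im - (Ψ (ptc z)).im))
      {z | 0 < z.im} := by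
    refine ((hGd.sub hGd').const_mul Complex.I).congr fun z hz => ?_
    simp only [Pi.sub_apply, hderiv z hz]
    ring
  obtain ⟨b, hb⟩ := eq_const_of_boundary hKd (continuousOn_const.mul (hHc.sub hHc'))
    ((hN.sub hN').const_mul Complex.I) (fun x => by simp [hHb, hHb'])
  -- The constant `a₁ i e₁ + a₂ e₂` has base `i(a₁ + a₂)` and `ρ`-coefficient `a₂`, to be matched
  -- with `ia` and `b`.
  refine ⟨a - b, b, ?_⟩
  rintro _ ⟨x, y, hy, rfl⟩
  rw [pt_eq_ptc]
  have h1 := ha ⟨x, y⟩ hy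
  have h2 := hb ⟨x, y⟩ hy
  simp only [Pi.sub_apply] at h1
  rw [mul_comm, mul_left_inj' Complex.I_ne_zero] at h2
  refine ext_base ?_ ?_
  · simp
    linear_combination h1
  · simp
    linear_combination h2

end Biharm

/-! ### The main theorem -/

open Biharm in
theorem theorem3 (u₁ u₄ : ℝ → ℝ) (c₁ c₄ : ℝ)
    (hlim₁ : Tendsto u₁ (cobounded ℝ) (𝓝 c₁)) (hlim₄ : Tendsto u₄ (cobounded ℝ) (𝓝 c₄))
    (hdini₁ : Dini (modulus u₁)) (hdini₄ : Dini (modulus u₄))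
    (hdini_infty₁ : Dini (modulusInfty u₁ c₁)) (hdini_infty₄ : Dini (modulusInfty u₄ c₄)) :
    (∀ ζ ∈ halfPlane, HasPV (schwarzIntegrand u₁ ζ) (pv (schwarzIntegrand u₁ ζ)) ∧
      HasPV (schwarzIntegrand u₄ ζ) (pv (schwarzIntegrand u₄ ζ))) ∧
    (∀ Φ : Biharm → Biharm, IsSolution14 u₁ u₄ Φ →
      ∃ a₁ a₂ : ℝ, ∀ ζ ∈ halfPlane, Φ ζ = solutionFormula u₁ u₄ a₁ a₂ ζ) ∧
    (∀ a₁ a₂ : ℝ, ∃ Φ : Biharm → Biharm, IsSolution14 u₁ u₄ Φ ∧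
      ∀ ζ ∈ halfPlane, Φ ζ = solutionFormula u₁ u₄ a₁ a₂ ζ) := by
  have hu₁ := SchwarzIntegral.continuous_of_dini hdini₁
  have hu₄ := SchwarzIntegral.continuous_of_dini hdini₄
  obtain ⟨M₁, hM₁⟩ := SchwarzIntegral.exists_bound hu₁ hlim₁
  obtain ⟨M₄, hM₄⟩ := SchwarzIntegral.exists_bound hu₄ hlim₄
  obtain ⟨g₁, ψ₁, h₁⟩ := SchwarzIntegral.exists_diniMajorants hlim₁ hdini₁ hdini_infty₁
  obtain ⟨g₄, ψ₄, h₄⟩ := SchwarzIntegral.exists_diniMajorants hlim₄ hdini₄ hdini_infty₄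
  have hex := exists_solution h₁ h₄ hu₁ hM₁ hu₄ hM₄
  refine ⟨?_, fun Φ hΦ => ?_, hex⟩
  · rintro _ ⟨x, y, hy, rfl⟩
    have hp₁ := hasPV_schwarzIntegrand hu₁ hM₁ (z := ⟨x, y⟩) hy
    have hp₄ := hasPV_schwarzIntegrand hu₄ hM₄ (z := ⟨x, y⟩) hy
    rw [pt_eq_ptc, hasPV_pv hp₁, hasPV_pv hp₄]
    exact ⟨hp₁, hp₄⟩
  · obtain ⟨Ψ, hΨ, hΨf⟩ := hex 0 0
    obtain ⟨a₁, a₂, h⟩ := solution_sub_solution hΦ hΨ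
    refine ⟨a₁, a₂, fun ζ hζ => ?_⟩
    rw [h ζ hζ, hΨf ζ hζ]
    simp [solutionFormula]
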